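/- A path in an edge-colored graph is called conflict-free if some color is used on exactly one of its edges. Two distinct vertices $u,v$ of an edge-colored graph $G$ are called strongly conflict-free connected if there is a conflict-free path between $u$ and $v$ whose length is the distance $d_G(u,v)$. Theorem. There is a polynomial-time algorithm for the following decision problem. Input: a finite simple graph $G=(V,E)$, an integer $k\ge 1$, an edge-coloring $c:E\to\{1,\dots,k\}$ and a set $P\subseteq V\times V$. Question: is every pair $(u,v)\in P$ of distinct vertices strongly conflict-free connected in $G$ under $c$? More precisely, there is a (multi-stack) Turing machine that, for every such input, written as a word over a finite alphabet which lists $|V|$, $k$, the edges with their colors, and the pairs in $P$, with all numbers in binary, halts with the correct answer after a number of steps that is at most a fixed polynomial in the length of the input word. -/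

import Mathlib

open Computability

/-- A walk in an edge-colored graph is conflict-free if some color is used on exactly one of its
edges. It is applied to paths only, and these do not repeat edges. -/
def SimpleGraph.Walk.IsConflictFree {V C : Type*} {G : SimpleGraph V} (c : G.edgeSet → C)
    {u v : V} (p : G.Walk u v) : Prop :=
  ∃ i : C, ∃! e : G.edgeSet, (e : Sym2 V) ∈ p.edges ∧ c e = i

/-- `u` and `v` are strongly conflict-free connected: some shortest `u`-`v`-path is conflict-free. -/
def SimpleGraph.StronglyConflictFreeConnectedPair {V C : Type*} (G : SimpleGraph V)
    (c : G.edgeSet → C) (u v : V) : Prop :=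
  ∃ p : G.Walk u v, p.IsPath ∧ p.length = G.dist u v ∧ p.IsConflictFree c

/-- All pairs of distinct vertices in `P` are strongly conflict-free connected. -/
def SimpleGraph.SubsetStronglyConflictFreeConnected {V C : Type*} (G : SimpleGraph V)
    (c : G.edgeSet → C) (P : Set (V × V)) : Prop :=
  ∀ q ∈ P, q.1 ≠ q.2 → G.StronglyConflictFreeConnectedPair c q.1 q.2

/-- An input of the decision problem: a finite simple graph on the vertices `0, …, n - 1`, an
edge-coloring with `k ≥ 1` colors, and a set of pairs of vertices. -/
structure ColoredGraphWithPairs where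
  n : ℕ
  k : ℕ
  one_le_k : 1 ≤ k
  G : SimpleGraph (Fin n)
  c : G.edgeSet → Fin k
  P : Set (Fin n × Fin n)

namespace ColoredGraphWithPairs

open Classical in
/-- The edges `uv` with `u < v`, each with its color, in lexicographic order. -/
noncomputable def edgeList (I : ColoredGraphWithPairs) : List (Fin I.n × Fin I.n × Fin I.k) :=
  (List.finRange I.n).flatMap fun u => (List.finRange I.n).filterMap fun v =>
    if h : u < v ∧ I.G.Adj u v then some (u, v, I.c ⟨s(u, v), h.2⟩) else none

open Classical in
/-- The pairs in `P`, in lexicographic order. -/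
noncomputable def pairList (I : ColoredGraphWithPairs) : List (Fin I.n × Fin I.n) :=
  (List.finRange I.n).flatMap fun u => (List.finRange I.n).filterMap fun v =>
    if (u, v) ∈ I.P then some (u, v) else none

/-- A natural number, written in binary. -/
def encodeNumber (a : ℕ) : List Γ' := encodingNatΓ'.encode a

/-- The input word: `n` and `k`, then the colored edges `(u,v,i)`, then a blank, then the pairs
`(u,v)` in `P`; all numbers are written in binary. -/
noncomputable def encode (I : ColoredGraphWithPairs) : List Γ' :=
  encodeNumber I.n ++ [Γ'.comma] ++ encodeNumber I.k ++ [Γ'.comma] ++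
    (I.edgeList.flatMap fun e =>
      [Γ'.bra] ++ encodeNumber e.1 ++ [Γ'.comma] ++ encodeNumber e.2.1 ++ [Γ'.comma] ++
        encodeNumber e.2.2 ++ [Γ'.ket]) ++
    [Γ'.blank] ++
    (I.pairList.flatMap fun q =>
      [Γ'.bra] ++ encodeNumber q.1 ++ [Γ'.comma] ++ encodeNumber q.2 ++ [Γ'.ket])

end ColoredGraphWithPairs

/-!
The algorithm rests on the following observation. A walk of length `d(u, v)` from `u` to `v` is a
path, so `u` and `v` are strongly conflict-free connected if and only if, for some color `i`, there
is a walk of length `d(u, v)` from `u` to `v` that has exactly one edge of color `i`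
(`SimpleGraph.stronglyConflictFreeConnectedPair_iff`). For fixed `u`, `v` and `i`, let `A`, `B` and
`C` be the sets of the ends of all walks of length `t` that start at `u`, of those without an edge
of color `i`, and of those with exactly one. The sets for `t + 1` are obtained from those for `t` by
one pass over the edges, and the first `t` with `v ∈ A` is `d(u, v)`; then it remains to see
whether `v ∈ C`. As `d(u, v)` is at most the number of arcs, that many rounds are enough, for
each pair in `P` and each color of an edge. That the number of vertices is written in binary does no
harm, since only the ends of edges are ever listed. The correctness of the search is
`ConflictFree.search_iff`, and that of the whole algorithm `ConflictFree.decideWord_encode_iff`.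

For the running time, stack machines are programmed in a small structured language (`StackProg`),
which is compiled to Turing machines step by step (`StackProg.Exec.compile_evals`). All data
are represented by binary trees, which lie on the stacks in Polish notation. As this is a prefix
code, a program can work on the tree on top of a stack, whatever lies below. A function is
`PolyTime` if such a program computes it in polynomial time. These functions are closed under
composition, pairing and case distinction, and under folds over lists, provided that one step of the
fold increases the size of the state at most by a polynomial in the size of the argument
(`PolyTime.foldl`). The algorithm is written as a function on lists of bit strings, so that its
running time follows from these closure properties (`ConflictFree.polyTime_decideWord`).
-/

/-! ### Structured programs for stack machines -/

/-- Programs that act on stacks indexed by `K`, with symbols of type `Γ k` on the stack `k`.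
`case k b` pops `k` and goes on with `b x`, where `x` is the popped symbol, or `none` if `k` was
empty. `loop k t b` pops `k`; if the popped symbol `x` satisfies `t x`, it executes `b x` and
starts again, otherwise it ends. -/
inductive StackProg {K : Type} (Γ : K → Type) : Type
  | skip : StackProg Γ
  | push (k : K) (x : Γ k) : StackProg Γ
  | seq (a b : StackProg Γ) : StackProg Γ
  | case (k : K) (b : Option (Γ k) → StackProg Γ) : StackProg Γ
  | loop (k : K) (t : Option (Γ k) → Bool) (b : Option (Γ k) → StackProg Γ) : StackProg Γ

namespace StackProg

variable {K : Type} {Γ : K → Type}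

section Exec
variable [DecidableEq K]

/-- `Exec c S n S'`: the program `c`, started on the stacks `S`, ends with the stacks `S'` after
exactly `n` steps. -/
inductive Exec : StackProg Γ → (∀ k, List (Γ k)) → ℕ → (∀ k, List (Γ k)) → Prop
  | skip (S) : Exec skip S 1 S
  | push (k x S) : Exec (push k x) S 1 (Function.update S k (x :: S k))
  | seq {a b S S₁ S₂ n m} : Exec a S n S₁ → Exec b S₁ m S₂ → Exec (seq a b) S (n + m) S₂
  | case {k b S S₁ n} : Exec (b (S k).head?) (Function.update S k (S k).tail) n S₁ →
      Exec (case k b) S (n + 1) S₁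
  | loop_exit {k t b S} : t (S k).head? = false →
      Exec (loop k t b) S 1 (Function.update S k (S k).tail)
  | loop_step {k t b S S₁ S₂ n m} : t (S k).head? = true →
      Exec (b (S k).head?) (Function.update S k (S k).tail) n S₁ →
      Exec (loop k t b) S₁ m S₂ → Exec (loop k t b) S (n + 1 + m) S₂

/-- `Runs c S n S'`: the program `c`, started on `S`, ends with `S'` after at most `n` steps. -/
def Runs (c : StackProg Γ) (S : ∀ k, List (Γ k)) (n : ℕ) (S' : ∀ k, List (Γ k)) : Prop :=
  ∃ m ≤ n, Exec c S m S'

theorem Runs.mono {c : StackProg Γ} {S S' n m} (h : Runs c S n S') (hnm : n ≤ m) :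
    Runs c S m S' :=
  let ⟨i, hi, e⟩ := h
  ⟨i, hi.trans hnm, e⟩

theorem Runs.seq {a b : StackProg Γ} {S S₁ S₂ n m} (h : Runs a S n S₁) (h' : Runs b S₁ m S₂) :
    Runs (seq a b) S (n + m) S₂ :=
  let ⟨_, hi, e⟩ := h
  let ⟨_, hj, e'⟩ := h'
  ⟨_, Nat.add_le_add hi hj, e.seq e'⟩

theorem Runs.skip (S : ∀ k, List (Γ k)) : Runs .skip S 1 S := ⟨1, le_rfl, .skip S⟩

theorem Runs.push {k : K} {x : Γ k} {S S' : ∀ k, List (Γ k)}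
    (h : Function.update S k (x :: S k) = S') : Runs (.push k x) S 1 S' :=
  ⟨1, le_rfl, h ▸ .push k x S⟩

theorem Runs.case {k : K} {b : Option (Γ k) → StackProg Γ} {S S₀ S₁ n x}
    (hx : (S k).head? = x) (h₀ : Function.update S k (S k).tail = S₀)
    (h : Runs (b x) S₀ n S₁) : Runs (.case k b) S (n + 1) S₁ := by
  subst hx h₀
  obtain ⟨i, hi, e⟩ := h
  exact ⟨_, Nat.add_le_add_right hi 1, e.case⟩

theorem Runs.loop_exit {k : K} {t : Option (Γ k) → Bool} {b S S₀ x}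
    (hx : (S k).head? = x) (h₀ : Function.update S k (S k).tail = S₀) (ht : t x = false) :
    Runs (.loop k t b) S 1 S₀ := by
  subst hx h₀
  exact ⟨1, le_rfl, .loop_exit ht⟩

theorem Runs.loop_step {k : K} {t : Option (Γ k) → Bool} {b S S₀ S₁ S₂ n m x}
    (hx : (S k).head? = x) (h₀ : Function.update S k (S k).tail = S₀) (ht : t x = true)
    (h : Runs (b x) S₀ n S₁) (h' : Runs (.loop k t b) S₁ m S₂) :
    Runs (.loop k t b) S (n + 1 + m) S₂ := by
  subst hx h₀
  obtain ⟨i, hi, e⟩ := h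
  obtain ⟨j, hj, e'⟩ := h'
  exact ⟨_, by omega, .loop_step ht e e'⟩

end Exec

/-! ### Compilation to Turing machines -/

/-- The labels of the machine code of a program. -/
def Label : StackProg Γ → Type
  | skip => Unit
  | push _ _ => Unit
  | seq a b => Label a ⊕ Label b
  | case k b => Option (Σ x : Option (Γ k), Label (b x))
  | loop k _ b => Option (Σ x : Option (Γ k), Label (b x))

/-- The label at which a program starts. -/
def entry : (c : StackProg Γ) → Label c
  | skip => ()
  | push _ _ => ()
  | seq a _ => Sum.inl (entry a)
  | case _ _ => none
  | loop _ _ _ => none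

/-- A program has finitely many labels. -/
@[reducible]
noncomputable def labelFintype [∀ k, Fintype (Γ k)] : (c : StackProg Γ) → Fintype (Label c)
  | skip => inferInstanceAs (Fintype Unit)
  | push _ _ => inferInstanceAs (Fintype Unit)
  | seq a b =>
    letI := labelFintype a
    letI := labelFintype b
    inferInstanceAs (Fintype (Label a ⊕ Label b))
  | case k b =>
    letI := fun x => labelFintype (b x)
    inferInstanceAs (Fintype (Option (Σ x : Option (Γ k), Label (b x))))
  | loop k _ b =>
    letI := fun x => labelFintype (b x)
    inferInstanceAs (Fintype (Option (Σ x : Option (Γ k), Label (b x))))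

variable [DecidableEq K]

/-- The machine code of a program, as part of a larger machine with labels `Λ`: the label `l` of
the program is the label `emb l` of the machine, and at its end the program jumps to `exit`.
The internal state records for each stack the symbol that was popped last. -/
def compile {Λ : Type} : (c : StackProg Γ) → (emb : Label c → Λ) → (exit : Λ) → Label c →
    Turing.TM2.Stmt Γ Λ (∀ k, Option (Γ k))
  | skip, _, exit, _ => .goto fun _ => exit
  | push k x, _, exit, _ => .push k (fun _ => x) (.goto fun _ => exit)
  | seq a b, emb, exit, l =>
    match l with
    | Sum.inl l => compile a (fun l => emb (Sum.inl l)) (emb (Sum.inr (entry b))) l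
    | Sum.inr l => compile b (fun l => emb (Sum.inr l)) exit l
  | case k b, emb, exit, l =>
    match l with
    | none => .pop k (fun v x => Function.update v k x)
        (.goto fun v => emb (some ⟨v k, entry (b (v k))⟩))
    | some ⟨x, l⟩ => compile (b x) (fun l => emb (some ⟨x, l⟩)) exit l
  | loop k t b, emb, exit, l =>
    match l with
    | none => .pop k (fun v x => Function.update v k x)
        (.branch (fun v => t (v k)) (.goto fun v => emb (some ⟨v k, entry (b (v k))⟩))
          (.goto fun _ => exit))
    | some ⟨x, l⟩ => compile (b x) (fun l => emb (some ⟨x, l⟩)) (emb none) l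

/-- The machine code of a program simulates it step by step. The internal state only transports the
popped symbols to the next jump, so its initial value does not matter. -/
theorem Exec.compile_evals {Λ : Type} {c : StackProg Γ} {S S' : ∀ k, List (Γ k)} {n : ℕ}
    (h : Exec c S n S') (M : Λ → Turing.TM2.Stmt Γ Λ (∀ k, Option (Γ k)))
    (emb : Label c → Λ) (exit : Λ) (hM : ∀ l, M (emb l) = compile c emb exit l)
    (v : ∀ k, Option (Γ k)) :
    ∃ v', (flip bind (Turing.TM2.step M))^[n] (some ⟨some (emb (entry c)), v, S⟩) =
      some ⟨some exit, v', S'⟩ := by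
  induction h generalizing exit v with
  | skip S => exact ⟨v, by simp [flip, hM (entry _)]; simp [compile]⟩
  | push k x S => exact ⟨v, by simp [flip, hM (entry _)]; simp [compile]⟩
  | @seq a b S S₁ S₂ n m _ _ iha ihb =>
    obtain ⟨v₁, h₁⟩ := iha (fun l => emb (Sum.inl l)) (emb (Sum.inr (entry b)))
      (fun l => hM (Sum.inl l)) v
    obtain ⟨v₂, h₂⟩ := ihb (fun l => emb (Sum.inr l)) exit (fun l => hM (Sum.inr l)) v₁
    refine ⟨v₂, ?_⟩
    rw [Nat.add_comm, Function.iterate_add_apply]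
    exact (congrArg _ h₁).trans h₂
  | @case k b S S₁ n _ ih =>
    obtain ⟨v₁, h₁⟩ := ih (fun l => emb (some ⟨_, l⟩)) exit (fun l => hM (some ⟨_, l⟩))
      (Function.update v k (S k).head?)
    refine ⟨v₁, ?_⟩
    rw [Function.iterate_add_apply, Function.iterate_one, ← h₁]
    congr 1
    simp [flip, hM (entry _)]
    simp [entry, compile]
    rw [Function.update_self]
  | @loop_exit k t b S ht =>
    exact ⟨Function.update v k (S k).head?, by
      simp [flip, hM (entry _)]
      simp [entry, compile, ht]⟩
  | @loop_step k t b S S₁ S₂ n m ht _ _ ih ih' =>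
    obtain ⟨v₁, h₁⟩ := ih (fun l => emb (some ⟨_, l⟩)) (emb none) (fun l => hM (some ⟨_, l⟩))
      (Function.update v k (S k).head?)
    obtain ⟨v₂, h₂⟩ := ih' emb exit hM v₁
    refine ⟨v₂, ?_⟩
    rw [Nat.add_comm, Function.iterate_add_apply, Function.iterate_add_apply,
      Function.iterate_one, ← h₂]
    congr 1
    change _ = some (Turing.TM2.Cfg.mk (some (emb none)) v₁ S₁)
    rw [← h₁]
    congr 1
    simp [flip, hM (entry _)]
    simp [entry, compile, ht]
    rw [Function.update_self]

end StackProg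

/-! ### Binary trees as a universal data type -/

/-- Binary trees. All data are represented by them. -/
inductive BinTree : Type
  | leaf : BinTree
  | node (l r : BinTree) : BinTree

namespace BinTree

/-- The Polish notation of a tree. It is a prefix code, so that a tree can be read off a stack on
which other data lie below it. -/
def word : BinTree → List Bool
  | leaf => [false]
  | node l r => true :: (word l ++ word r)

/-- The length of the Polish notation of a tree. -/
def size (x : BinTree) : ℕ := x.word.length

@[simp] theorem size_leaf : leaf.size = 1 := rfl

@[simp] theorem size_node (l r : BinTree) : (node l r).size = l.size + r.size + 1 := by
  simp [size, word]

theorem size_pos (x : BinTree) : 0 < x.size := by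
  cases x <;> simp

end BinTree

/-- A representation of the elements of `α` by binary trees. -/
class TreeCode (α : Type) where
  /-- The tree that represents an element. -/
  code : α → BinTree

namespace TreeCode

/-- The size of the tree that represents an element. -/
def size {α : Type} [TreeCode α] (a : α) : ℕ := (code a).size

theorem size_pos {α : Type} [TreeCode α] (a : α) : 0 < size a := BinTree.size_pos _

/-- The bits are the two smallest trees. -/
instance instBool : TreeCode Bool where
  code b := bif b then .node .leaf .leaf else .leaf

instance instProd {α β : Type} [TreeCode α] [TreeCode β] : TreeCode (α × β) where
  code x := .node (code x.1) (code x.2)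

/-- The tree of a list. -/
def listCode {α : Type} [TreeCode α] : List α → BinTree
  | [] => .leaf
  | a :: l => .node (code a) (listCode l)

instance instList {α : Type} [TreeCode α] : TreeCode (List α) where
  code := listCode

variable {α β : Type} [TreeCode α] [TreeCode β]

@[simp] theorem code_true : code true = .node .leaf .leaf := rfl

@[simp] theorem code_false : code false = .leaf := rfl

@[simp] theorem code_pair (a : α) (b : β) : code (a, b) = .node (code a) (code b) := rfl

@[simp] theorem code_nil : code ([] : List α) = .leaf := rfl

@[simp] theorem code_cons (a : α) (l : List α) : code (a :: l) = .node (code a) (code l) := rfl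

theorem size_bool_le (b : Bool) : size b ≤ 3 := by
  cases b <;> simp [size]

@[simp] theorem size_pair (a : α) (b : β) : size (a, b) = size a + size b + 1 := by
  simp [size]

@[simp] theorem size_nil : size ([] : List α) = 1 := rfl

@[simp] theorem size_cons (a : α) (l : List α) : size (a :: l) = size a + size l + 1 := by
  simp [size]

theorem size_le_of_mem {a : α} {l : List α} (h : a ∈ l) : size a ≤ size l := by
  induction l with
  | nil => cases h
  | cons b l ih =>
    rw [size_cons]
    rcases List.mem_cons.1 h with rfl | h
    · omega
    · have := ih h; omega

theorem length_le_size (l : List α) : l.length ≤ size l := by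
  induction l with
  | nil => simp
  | cons b l ih => rw [size_cons, List.length_cons]; omega

end TreeCode

/-! ### Programs on trees -/

/-- The stacks of the machines: the input, the main data stack, a second data stack, a stack
through which trees are moved, and a unary counter. -/
inductive WorkStack : Type
  | inp | main | stash | tmp | cnt
  deriving DecidableEq

instance : Fintype WorkStack :=
  ⟨{.inp, .main, .stash, .tmp, .cnt}, fun k => by cases k <;> simp⟩

/-- The alphabets of the stacks: the input alphabet for the input, and bits elsewhere. -/
@[reducible]
def WorkStack.Symbol : WorkStack → Type
  | .inp => Γ'
  | .main | .stash | .tmp | .cnt => Bool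

instance : ∀ k : WorkStack, Fintype k.Symbol
  | .inp => inferInstanceAs (Fintype Γ')
  | .main | .stash | .tmp | .cnt => inferInstanceAs (Fintype Bool)

/-- The stacks with given contents. -/
def contents (i : List Γ') (m s t c : List Bool) : ∀ k : WorkStack, List k.Symbol
  | .inp => i
  | .main => m
  | .stash => s
  | .tmp => t
  | .cnt => c

section contents
variable (i i' : List Γ') (m s t c x : List Bool)

@[simp] theorem update_inp : Function.update (contents i m s t c) .inp i' =
    contents i' m s t c := by
  funext k; cases k <;> rfl

@[simp] theorem update_main : Function.update (contents i m s t c) .main x =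
    contents i x s t c := by
  funext k; cases k <;> rfl

@[simp] theorem update_stash : Function.update (contents i m s t c) .stash x =
    contents i m x t c := by
  funext k; cases k <;> rfl

@[simp] theorem update_tmp : Function.update (contents i m s t c) .tmp x = contents i m s x c := by
  funext k; cases k <;> rfl

@[simp] theorem update_cnt : Function.update (contents i m s t c) .cnt x = contents i m s t x := by
  funext k; cases k <;> rfl

end contents

namespace StackProg
open BinTree WorkStack

/-- Programs on the stacks of `WorkStack`. -/
abbrev WorkProg := StackProg WorkStack.Symbol

theorem push_main_runs (b i m s t c) : Runs (.push .main b : WorkProg) (contents i m s t c) 1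
    (contents i (b :: m) s t c) := .push (by simp [contents])

theorem push_stash_runs (b i m s t c) : Runs (.push .stash b : WorkProg) (contents i m s t c) 1
    (contents i m (b :: s) t c) := .push (by simp [contents])

theorem push_tmp_runs (b i m s t c) : Runs (.push .tmp b : WorkProg) (contents i m s t c) 1
    (contents i m s (b :: t) c) := .push (by simp [contents])

theorem push_cnt_runs (b i m s t c) : Runs (.push .cnt b : WorkProg) (contents i m s t c) 1
    (contents i m s t (b :: c)) := .push (by simp [contents])

/-- Move all of `tmp` to `main`. -/
def tmpToMain : WorkProg :=
  .loop .tmp (fun x => x.isSome) fun x => .push .main (x.getD false)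

/-- Move all of `tmp` to `stash`. -/
def tmpToStash : WorkProg :=
  .loop .tmp (fun x => x.isSome) fun x => .push .stash (x.getD false)

/-- Move all of `tmp` to both `main` and `stash`. -/
def tmpToBoth : WorkProg :=
  .loop .tmp (fun x => x.isSome) fun x =>
    .seq (.push .main (x.getD false)) (.push .stash (x.getD false))

/-- Read the tree on top of `main` and put its reverse on `tmp`. The counter holds the number of
subtrees that are still to be read. -/
def mainTreeToTmp : WorkProg :=
  .seq (.push .cnt true) (.loop .cnt (fun x => x.isSome) fun _ => .case .main fun x =>
    bif x.getD false then
      .seq (.push .tmp true) (.seq (.push .cnt true) (.push .cnt true))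
    else .push .tmp false)

/-- Read the tree on top of `stash` and put its reverse on `tmp`. -/
def stashTreeToTmp : WorkProg :=
  .seq (.push .cnt true) (.loop .cnt (fun x => x.isSome) fun _ => .case .stash fun x =>
    bif x.getD false then
      .seq (.push .tmp true) (.seq (.push .cnt true) (.push .cnt true))
    else .push .tmp false)

/-- Empty `tmp`. -/
def clearTmp : WorkProg := .loop .tmp (fun x => x.isSome) fun _ => .skip

/-- Remove the tree on top of `main`. This also empties `tmp`. -/
def dropMain : WorkProg := .seq mainTreeToTmp clearTmp

theorem tmpToMain_runs (i m s t c) :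
    Runs tmpToMain (contents i m s t c) (2 * t.length + 1)
      (contents i (t.reverse ++ m) s [] c) := by
  induction t generalizing m with
  | nil => exact (Runs.loop_exit rfl (by simp [contents]) rfl).mono (by simp)
  | cons b t ih =>
    refine (Runs.loop_step (x := some b) (n := 1) (m := 2 * t.length + 1) rfl
      (by simp [contents]; rfl) rfl (push_main_runs ..) ?_).mono (by simp; omega)
    simpa [tmpToMain] using ih (b :: m)

theorem tmpToStash_runs (i m s t c) :
    Runs tmpToStash (contents i m s t c) (2 * t.length + 1)
      (contents i m (t.reverse ++ s) [] c) := by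
  induction t generalizing s with
  | nil => exact (Runs.loop_exit rfl (by simp [contents]) rfl).mono (by simp)
  | cons b t ih =>
    refine (Runs.loop_step (x := some b) (n := 1) (m := 2 * t.length + 1) rfl
      (by simp [contents]; rfl) rfl (push_stash_runs ..) ?_).mono (by simp; omega)
    simpa [tmpToStash] using ih (b :: s)

theorem tmpToBoth_runs (i m s t c) :
    Runs tmpToBoth (contents i m s t c) (3 * t.length + 1)
      (contents i (t.reverse ++ m) (t.reverse ++ s) [] c) := by
  induction t generalizing m s with
  | nil => exact (Runs.loop_exit rfl (by simp [contents]) rfl).mono (by simp)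
  | cons b t ih =>
    refine (Runs.loop_step (x := some b) (n := 2) (m := 3 * t.length + 1) rfl
      (by simp [contents]; rfl) rfl ((push_main_runs ..).seq (push_stash_runs ..)) ?_).mono
      (by simp; omega)
    simpa [tmpToBoth] using ih (b :: m) (b :: s)

theorem clearTmp_runs (i m s t c) :
    Runs clearTmp (contents i m s t c) (2 * t.length + 1) (contents i m s [] c) := by
  induction t generalizing m with
  | nil => exact (Runs.loop_exit rfl (by simp [contents]) rfl).mono (by simp)
  | cons b t ih =>
    refine (Runs.loop_step (x := some b) (n := 1) (m := 2 * t.length + 1) rfl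
      (by simp [contents]; rfl) rfl (Runs.skip _) ?_).mono (by simp; omega)
    simpa [clearTmp] using ih m

theorem mainTreeToTmp_runs (x : BinTree) (i m s t) :
    Runs mainTreeToTmp (contents i (x.word ++ m) s t []) (6 * x.size + 2)
      (contents i m s (x.word.reverse ++ t) []) := by
  -- the rest of the loop is a hypothesis, so that the two subtrees can be read one after the other
  have key : ∀ (x : BinTree) m t c S' n,
      Runs (.loop .cnt (fun x => x.isSome) fun _ => .case .main fun x =>
        bif x.getD false then
          .seq (.push .tmp true) (.seq (.push .cnt true) (.push .cnt true))
        else .push .tmp false : WorkProg) (contents i m s (x.word.reverse ++ t) c) n S' →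
      Runs (.loop .cnt (fun x => x.isSome) fun _ => .case .main fun x =>
        bif x.getD false then
          .seq (.push .tmp true) (.seq (.push .cnt true) (.push .cnt true))
        else .push .tmp false : WorkProg) (contents i (x.word ++ m) s t (true :: c))
        (6 * x.size + n) S' := by
    intro x
    induction x with
    | leaf =>
      intro m t c S' n h
      exact (Runs.loop_step (x := some true) rfl (by simp [contents]; rfl) rfl
        (Runs.case (x := some false) rfl (by simp [contents, word])
          (push_tmp_runs ..)) h).mono (by simp)
    | node l r ihl ihr =>
      intro m t c S' n h
      have h₁ := ihl (r.word ++ m) (true :: t) (true :: c) S' _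
        (ihr m (l.word.reverse ++ true :: t) c S' n (by simpa [word] using h))
      refine (Runs.loop_step (x := some true) rfl (by simp [contents]; rfl) rfl
        (Runs.case (x := some true) rfl (by simp [contents, word])
          ((push_tmp_runs ..).seq ((push_cnt_runs ..).seq (push_cnt_runs ..)))) h₁).mono ?_
      simp; omega
  refine ((push_cnt_runs ..).seq (key x m t [] _ _
    (Runs.loop_exit rfl (by simp [contents]) rfl))).mono (by omega)

theorem stashTreeToTmp_runs (x : BinTree) (i m s t) :
    Runs stashTreeToTmp (contents i m (x.word ++ s) t []) (6 * x.size + 2)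
      (contents i m s (x.word.reverse ++ t) []) := by
  have key : ∀ (x : BinTree) s t c S' n,
      Runs (.loop .cnt (fun x => x.isSome) fun _ => .case .stash fun x =>
        bif x.getD false then
          .seq (.push .tmp true) (.seq (.push .cnt true) (.push .cnt true))
        else .push .tmp false : WorkProg) (contents i m s (x.word.reverse ++ t) c) n S' →
      Runs (.loop .cnt (fun x => x.isSome) fun _ => .case .stash fun x =>
        bif x.getD false then
          .seq (.push .tmp true) (.seq (.push .cnt true) (.push .cnt true))
        else .push .tmp false : WorkProg) (contents i m (x.word ++ s) t (true :: c))
        (6 * x.size + n) S' := by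
    intro x
    induction x with
    | leaf =>
      intro s t c S' n h
      exact (Runs.loop_step (x := some true) rfl (by simp [contents]; rfl) rfl
        (Runs.case (x := some false) rfl (by simp [contents, word])
          (push_tmp_runs ..)) h).mono (by simp)
    | node l r ihl ihr =>
      intro s t c S' n h
      have h₁ := ihl (r.word ++ s) (true :: t) (true :: c) S' _
        (ihr s (l.word.reverse ++ true :: t) c S' n (by simpa [word] using h))
      refine (Runs.loop_step (x := some true) rfl (by simp [contents]; rfl) rfl
        (Runs.case (x := some true) rfl (by simp [contents, word])
          ((push_tmp_runs ..).seq ((push_cnt_runs ..).seq (push_cnt_runs ..)))) h₁).mono ?_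
      simp; omega
  refine ((push_cnt_runs ..).seq (key x s t [] _ _
    (Runs.loop_exit rfl (by simp [contents]) rfl))).mono (by omega)

theorem dropMain_runs (x : BinTree) (i m s) :
    Runs dropMain (contents i (x.word ++ m) s [] []) (8 * x.size + 3) (contents i m s [] []) := by
  refine ((mainTreeToTmp_runs x i m s []).seq (clearTmp_runs ..)).mono ?_
  simp [size]; omega

end StackProg

/-! ### Polynomial-time functions -/

theorem Polynomial.eval_nat_mono (p : Polynomial ℕ) : Monotone fun n => p.eval n := by
  intro a b h
  induction p using Polynomial.induction_on' with
  | add p q hp hq => simpa using Nat.add_le_add hp hq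
  | monomial n c =>
    simpa using Nat.mul_le_mul_left c (Nat.pow_le_pow_left h n)

open TreeCode StackProg

/-- The word that represents an element on a stack. -/
def TreeCode.bits {α : Type} [TreeCode α] (a : α) : List Bool := (code a).word

/-- `f` is computed in polynomial time by a program that replaces its argument, on top of the main
stack, by its value, whatever lies below on the two data stacks. The polynomial also bounds the
size of the value. -/
@[fun_prop]
def PolyTime {α β : Type} [TreeCode α] [TreeCode β] (f : α → β) : Prop :=
  ∃ (c : WorkProg) (p : Polynomial ℕ), ∀ a,
    size (f a) ≤ p.eval (size a) ∧ ∀ m s, Runs c (contents [] (bits a ++ m) s [] [])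
      (p.eval (size a)) (contents [] (bits (f a) ++ m) s [] [])

namespace PolyTime

variable {α β γ σ : Type} [TreeCode α] [TreeCode β] [TreeCode γ] [TreeCode σ]

theorem size_le {f : α → β} (hf : PolyTime f) :
    ∃ q : Polynomial ℕ, ∀ a, size (f a) ≤ q.eval (size a) :=
  let ⟨_, p, h⟩ := hf
  ⟨p, fun a => (h a).1⟩

/-- A function that does not change the representation is computed by doing nothing. -/
theorem of_code_eq {f : α → β} (h : ∀ a, code (f a) = code a) : PolyTime f := by
  refine ⟨.skip, Polynomial.X + 1, fun a => ⟨?_, fun m s => ?_⟩⟩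
  · simp [size, h]
  · simp only [bits, h]
    exact (Runs.skip _).mono (by simp)

@[fun_prop]
protected theorem id : PolyTime (fun a : α => a) := of_code_eq fun _ => rfl

@[fun_prop]
theorem comp {g : β → γ} {f : α → β} (hg : PolyTime g) (hf : PolyTime f) :
    PolyTime fun a => g (f a) := by
  obtain ⟨c, p, hf⟩ := hf
  obtain ⟨d, q, hg⟩ := hg
  refine ⟨.seq c d, p + q.comp p, fun a => ?_⟩
  have hq : q.eval (size (f a)) ≤ q.eval (p.eval (size a)) := q.eval_nat_mono (hf a).1
  simp only [Polynomial.eval_add, Polynomial.eval_comp]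
  refine ⟨((hg _).1.trans hq).trans (Nat.le_add_left _ _), fun m s => ?_⟩
  exact (((hf a).2 m s).seq ((hg _).2 m s)).mono (Nat.add_le_add_left hq _)

theorem pushWord_runs (w : List Bool) : ∃ c : WorkProg, ∀ m s,
    Runs c (contents [] m s [] []) (w.length + 1) (contents [] (w ++ m) s [] []) := by
  induction w with
  | nil => exact ⟨.skip, fun m s => Runs.skip _⟩
  | cons b w ih =>
    obtain ⟨c, hc⟩ := ih
    exact ⟨.seq c (.push .main b), fun m s => (hc m s).seq (push_main_runs ..)⟩

@[fun_prop]
protected theorem const (b : β) : PolyTime (fun _ : α => b) := by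
  obtain ⟨c, hc⟩ := pushWord_runs (bits b)
  refine ⟨.seq dropMain c, 8 * Polynomial.X + Polynomial.C (size b + 4), fun a => ?_⟩
  simp only [Polynomial.eval_add, Polynomial.eval_mul, Polynomial.eval_ofNat, Polynomial.eval_X,
    Polynomial.eval_C]
  refine ⟨by omega, fun m s => ?_⟩
  refine ((dropMain_runs ..).seq (hc m s)).mono ?_
  simp only [size, BinTree.size, bits]; omega

/-- A function that takes the left subtree, and keeps the leaf, as `Prod.fst` and the head of a list
do. -/
theorem of_left {f : α → β} (h : ∀ a, (code a = .leaf ∧ code (f a) = .leaf) ∨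
    ∃ r, code a = .node (code (f a)) r) : PolyTime f := by
  refine ⟨.case .main fun x => bif x.getD false then
    .seq mainTreeToTmp (.seq tmpToStash (.seq dropMain (.seq stashTreeToTmp tmpToMain)))
    else .push .main false, 16 * Polynomial.X + 10, fun a => ?_⟩
  simp only [Polynomial.eval_add, Polynomial.eval_mul, Polynomial.eval_ofNat, Polynomial.eval_X]
  rcases h a with ⟨h₁, h₂⟩ | ⟨r, h₁⟩
  · refine ⟨by simp [size, h₁, h₂], fun m s => ?_⟩
    simp only [bits, h₁, h₂]
    exact (Runs.case (x := some false) rfl (by simp [contents, BinTree.word])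
      (push_main_runs ..)).mono (by omega)
  · refine ⟨by simp [size, h₁]; omega, fun m s => ?_⟩
    simp only [bits, h₁]
    have h₂ := (mainTreeToTmp_runs (code (f a)) [] (r.word ++ m) s []).seq
      ((tmpToStash_runs ..).seq ((dropMain_runs r [] m _).seq (Runs.seq
        (by simpa using stashTreeToTmp_runs (code (f a)) [] m s []) (tmpToMain_runs ..))))
    refine (Runs.case (x := some true) rfl (by simp [contents, BinTree.word]; rfl)
      (by simpa using h₂)).mono ?_
    simp [size, h₁, BinTree.size, BinTree.word]; omega

/-- A function that takes the right subtree, and keeps the leaf, as `Prod.snd` and `List.tail`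
do. -/
theorem of_right {f : α → β} (h : ∀ a, (code a = .leaf ∧ code (f a) = .leaf) ∨
    ∃ l, code a = .node l (code (f a))) : PolyTime f := by
  refine ⟨.case .main fun x => bif x.getD false then dropMain else .push .main false,
    8 * Polynomial.X + 4, fun a => ?_⟩
  simp only [Polynomial.eval_add, Polynomial.eval_mul, Polynomial.eval_ofNat, Polynomial.eval_X]
  rcases h a with ⟨h₁, h₂⟩ | ⟨l, h₁⟩
  · refine ⟨by simp [size, h₁, h₂], fun m s => ?_⟩
    simp only [bits, h₁, h₂]
    exact (Runs.case (x := some false) rfl (by simp [contents, BinTree.word])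
      (push_main_runs ..)).mono (by omega)
  · refine ⟨by simp [size, h₁]; omega, fun m s => ?_⟩
    simp only [bits, h₁]
    refine (Runs.case (x := some true) rfl (by simp [contents, BinTree.word]; rfl)
      (by simpa using dropMain_runs l [] ((code (f a)).word ++ m) s)).mono ?_
    simp [size, h₁]; omega

@[fun_prop]
theorem fst {f : α → β × γ} (hf : PolyTime f) : PolyTime fun a => (f a).1 :=
  (of_left (f := Prod.fst) fun x => .inr ⟨code x.2, rfl⟩).comp hf

@[fun_prop]
theorem snd {f : α → β × γ} (hf : PolyTime f) : PolyTime fun a => (f a).2 :=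
  (of_right (f := Prod.snd) fun x => .inr ⟨code x.1, rfl⟩).comp hf

@[fun_prop]
theorem tail {f : α → List β} (hf : PolyTime f) : PolyTime fun a => (f a).tail :=
  (of_right (f := List.tail) fun l => by
    cases l
    · exact .inl ⟨rfl, rfl⟩
    · exact .inr ⟨_, rfl⟩).comp hf

@[fun_prop]
theorem headD_nil {f : α → List (List β)} (hf : PolyTime f) :
    PolyTime fun a => (f a).headD [] :=
  (of_left (f := fun l : List (List β) => l.headD []) fun l => by
    cases l
    · exact .inl ⟨rfl, rfl⟩
    · exact .inr ⟨_, rfl⟩).comp hf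

@[fun_prop]
theorem headD_false {f : α → List Bool} (hf : PolyTime f) :
    PolyTime fun a => (f a).headD false :=
  (of_left (f := fun l : List Bool => l.headD false) fun l => by
    cases l
    · exact .inl ⟨rfl, rfl⟩
    · exact .inr ⟨_, rfl⟩).comp hf

@[fun_prop]
theorem isEmpty {f : α → List β} (hf : PolyTime f) : PolyTime fun a => (f a).isEmpty := by
  refine comp (g := fun l : List β => l.isEmpty) ?_ hf
  obtain ⟨c, hc⟩ := pushWord_runs (bits true)
  refine ⟨.case .main fun x => bif x.getD false then
    .seq dropMain (.seq dropMain (.push .main false)) else c,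
    16 * Polynomial.X + 20, fun l => ?_⟩
  simp only [Polynomial.eval_add, Polynomial.eval_mul, Polynomial.eval_ofNat, Polynomial.eval_X]
  refine ⟨(size_bool_le _).trans (by omega), fun m s => ?_⟩
  cases l with
  | nil =>
    refine (Runs.case (x := some false) rfl (by simp [contents, bits, BinTree.word])
      (hc ..)).mono ?_
    simp [bits, BinTree.word]
  | cons b l =>
    have h := (dropMain_runs (code b) [] ((code l).word ++ m) s).seq
      ((dropMain_runs (code l) [] m s).seq (push_main_runs false ..))
    refine (Runs.case (x := some true) rfl (by simp [contents, bits, BinTree.word]; rfl)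
      (by simpa [bits, BinTree.word] using h)).mono ?_
    rw [size_cons]
    simp only [size]; omega

@[fun_prop]
theorem pair {f : α → β} {g : α → γ} (hf : PolyTime f) (hg : PolyTime g) :
    PolyTime fun a => (f a, g a) := by
  obtain ⟨c, p, hf⟩ := hf
  obtain ⟨d, q, hg⟩ := hg
  refine ⟨.seq mainTreeToTmp (.seq tmpToBoth (.seq d (.seq stashTreeToTmp (.seq tmpToMain
    (.seq c (.push .main true)))))), p + q + 17 * Polynomial.X + 8, fun a => ?_⟩
  simp only [Polynomial.eval_add, Polynomial.eval_mul, Polynomial.eval_ofNat, Polynomial.eval_X]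
  refine ⟨?_, fun m s => ?_⟩
  · have := (hf a).1
    have := (hg a).1
    rw [size_pair]; omega
  · have h := (mainTreeToTmp_runs (code a) [] m s []).seq ((tmpToBoth_runs ..).seq
      (Runs.seq (by simpa [bits] using (hg a).2 m (bits a ++ s))
        ((stashTreeToTmp_runs (code a) [] _ s []).seq ((tmpToMain_runs ..).seq
        (Runs.seq (by simpa [bits] using (hf a).2 (bits (g a) ++ m) s) (push_main_runs true ..))))))
    refine Runs.mono (by simpa [bits, BinTree.word] using h) ?_
    simp [size, BinTree.size]; omega

@[fun_prop]
theorem cond {c : α → Bool} {f g : α → β} (hc : PolyTime c) (hf : PolyTime f) (hg : PolyTime g) :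
    PolyTime fun a => bif c a then f a else g a := by
  -- the program works on the pair of the condition and the argument
  suffices h : PolyTime fun x : Bool × α => bif x.1 then f x.2 else g x.2 from
    h.comp (hc.pair PolyTime.id)
  obtain ⟨d, p, hf⟩ := hf
  obtain ⟨e, q, hg⟩ := hg
  refine ⟨.case .main fun _ => .case .main fun x => bif x.getD false then
    .seq dropMain (.seq dropMain d) else e, p + q + 100, fun x => ?_⟩
  simp only [Polynomial.eval_add, Polynomial.eval_ofNat]
  obtain ⟨b, a⟩ := x
  have hp : p.eval (size a) ≤ p.eval (size (b, a)) := p.eval_nat_mono (by rw [size_pair]; omega)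
  have hq : q.eval (size a) ≤ q.eval (size (b, a)) := q.eval_nat_mono (by rw [size_pair]; omega)
  cases b with
  | false =>
    refine ⟨(hg a).1.trans (by omega), fun m s => ?_⟩
    exact (Runs.case (x := some true) rfl (by simp [contents, bits, BinTree.word]; rfl)
      (Runs.case (x := some false) rfl (by simp [contents]; rfl) ((hg a).2 m s))).mono (by omega)
  | true =>
    refine ⟨(hf a).1.trans (by omega), fun m s => ?_⟩
    have h := (dropMain_runs .leaf [] (BinTree.leaf.word ++ (bits a ++ m)) s).seq
      ((dropMain_runs .leaf [] (bits a ++ m) s).seq ((hf a).2 m s))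
    refine (Runs.case (x := some true) rfl (by simp [contents, bits, BinTree.word]; rfl)
      (Runs.case (x := some true) rfl (by simp [contents]; rfl) h)).mono ?_
    simp only [BinTree.size_leaf]; omega

@[fun_prop]
theorem cons {f : α → β} {g : α → List β} (hf : PolyTime f) (hg : PolyTime g) :
    PolyTime fun a => f a :: g a :=
  (of_code_eq (f := fun x : β × List β => x.1 :: x.2) fun _ => rfl).comp (hf.pair hg)

/-- The loop that folds `step` over the list on top of `stash`, with the state on top of `main`. -/
theorem foldl_runs (step : β × σ → σ) (c : WorkProg) (p : Polynomial ℕ)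
    (hc : ∀ x m s, Runs c (contents [] (bits x ++ m) s [] []) (p.eval (size x))
      (contents [] (bits (step x) ++ m) s [] [])) (M : ℕ) (l : List β) (t : σ) (m s : List Bool)
    (hM : ∀ l₁ b l₂, l = l₁ ++ b :: l₂ → size (b, l₁.foldl (fun t b => step (b, t)) t) ≤ M) :
    Runs (.loop .stash (fun x => x.getD false) fun _ =>
      .seq stashTreeToTmp (.seq tmpToMain (.seq (.push .main true) c)))
      (contents [] (bits t ++ m) (bits l ++ s) [] []) (l.length * (p.eval M + 8 * M + 5) + 1)
      (contents [] (bits (l.foldl (fun t b => step (b, t)) t) ++ m) s [] []) := by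
  induction l generalizing t with
  | nil =>
    exact (Runs.loop_exit (x := some false) rfl
      (by simp [contents, bits, BinTree.word]) rfl).mono (by simp)
  | cons b l ih =>
    have hb : size (b, t) ≤ M := hM [] b l rfl
    have ih' := ih (step (b, t)) fun l₁ b' l₂ e => hM (b :: l₁) b' l₂ (by rw [e]; rfl)
    have h := (stashTreeToTmp_runs (code b) [] (bits t ++ m) ((code l).word ++ s) []).seq
      ((tmpToMain_runs ..).seq ((push_main_runs true ..).seq
        (by simpa [bits, BinTree.word] using hc (b, t) m ((code l).word ++ s))))
    refine (Runs.loop_step (x := some true) rfl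
      (by simp [contents, bits, BinTree.word]; rfl) rfl
      (by simpa [bits, BinTree.word] using h) ih').mono ?_
    have hp : p.eval (size (b, t)) ≤ p.eval M := p.eval_nat_mono hb
    rw [size_pair] at hb hp
    have := TreeCode.size_pos t
    simp only [List.length_cons, Nat.add_mul]
    simp only [size, BinTree.size, List.length_append, List.length_reverse, List.length_nil] at *
    omega

/-- A fold over a list is computed in polynomial time if each step increases the size of the state
only by an amount that is bounded in terms of the size of the argument. -/
theorem foldl {f : α → List β} {g : α → σ} {h : α → σ → β → σ} (hf : PolyTime f)
    (hg : PolyTime g) (hh : PolyTime fun x : α × σ × β => h x.1 x.2.1 x.2.2)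
    (hsize : ∃ q : Polynomial ℕ, ∀ a s, ∀ b ∈ f a, size (h a s b) ≤ size s + q.eval (size a)) :
    PolyTime fun a => (f a).foldl (h a) (g a) := by
  obtain ⟨q, hq⟩ := hsize
  -- the argument is carried along in the state
  let step : β × (α × σ) → α × σ := fun x => (x.2.1, h x.2.1 x.2.2 x.1)
  have hstep : PolyTime step := by
    have h₁ : PolyTime fun x : β × (α × σ) => h x.2.1 x.2.2 x.1 :=
      comp (g := fun x : α × σ × β => h x.1 x.2.1 x.2.2)
        (f := fun x : β × (α × σ) => (x.2.1, x.2.2, x.1)) hh (by fun_prop)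
    fun_prop
  have hfold : ∀ a (l : List β) s, l.foldl (fun t b => step (b, t)) (a, s) =
      (a, l.foldl (h a) s) := by
    intro a l
    induction l with
    | nil => exact fun _ => rfl
    | cons b l ih => exact fun s => ih _
  suffices H : PolyTime fun a => (a, (f a).foldl (h a) (g a)) from H.snd
  obtain ⟨c, p, hc⟩ := hstep
  obtain ⟨pf, hpf⟩ := hf.size_le
  obtain ⟨pg, hpg⟩ := hg.size_le
  have hinit : PolyTime fun a => (f a, (a, g a)) := by fun_prop
  obtain ⟨d, p₀, hd⟩ := hinit
  -- bounds for the state without the argument, and for the argument of a step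
  let R : Polynomial ℕ := pg + pf * q
  let M : Polynomial ℕ := pf + Polynomial.X + R + 2
  have hR : ∀ a l₁ l₂, f a = l₁ ++ l₂ → size (l₁.foldl (h a) (g a)) ≤ R.eval (size a) := by
    intro a l₁ l₂ e
    have key : size (l₁.foldl (h a) (g a)) ≤ size (g a) + l₁.length * q.eval (size a) := by
      have : ∀ s, ∀ l ⊆ f a, size (l.foldl (h a) s) ≤ size s + l.length * q.eval (size a) := by
        intro s l
        induction l generalizing s with
        | nil => simp
        | cons b l ih =>
          intro hl
          have h₁ := ih (h a s b) fun x hx => hl (List.mem_cons_of_mem _ hx)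
          have h₂ := hq a s b (hl List.mem_cons_self)
          rw [List.length_cons, Nat.add_mul, List.foldl_cons]
          omega
      exact this _ _ (by simp [e])
    have hl : l₁.length ≤ pf.eval (size a) := by
      have h₁ := length_le_size (f a)
      have h₂ := hpf a
      have h₃ : l₁.length ≤ (f a).length := by simp [e]
      omega
    simp only [R, Polynomial.eval_add, Polynomial.eval_mul]
    exact key.trans (Nat.add_le_add (hpg a) (Nat.mul_le_mul_right _ hl))
  refine ⟨.seq d (.case .main fun _ => .seq mainTreeToTmp (.seq tmpToStash
      (.loop .stash (fun x => x.getD false) fun _ =>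
        .seq stashTreeToTmp (.seq tmpToMain (.seq (.push .main true) c))))),
    p₀ + 8 * pf + pf * (p.comp M + 8 * M + 5) + 5 + (Polynomial.X + R + 1), fun a => ?_⟩
  simp only [Polynomial.eval_add, Polynomial.eval_mul, Polynomial.eval_ofNat, Polynomial.eval_X,
    Polynomial.eval_comp, Polynomial.eval_one]
  constructor
  · have := hR a (f a) [] (by simp)
    rw [size_pair]; omega
  intro m s
  have hM : ∀ l₁ b l₂, f a = l₁ ++ b :: l₂ →
      size (b, l₁.foldl (fun t b => step (b, t)) (a, g a)) ≤ M.eval (size a) := by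
    intro l₁ b l₂ e
    rw [hfold, size_pair, size_pair]
    have h₁ := hR a l₁ _ e
    have h₂ : size b ≤ size (f a) := size_le_of_mem (by simp [e])
    have h₃ := hpf a
    simp only [M, Polynomial.eval_add, Polynomial.eval_ofNat, Polynomial.eval_X]
    omega
  have h₁ := foldl_runs step c p (fun x => (hc x).2) (M.eval (size a)) (f a) (a, g a) m s hM
  rw [hfold] at h₁
  have h₂ := (mainTreeToTmp_runs (code (f a)) [] (bits (a, g a) ++ m) s []).seq
    ((tmpToStash_runs ..).seq (by simpa [bits] using h₁))
  refine (((hd a).2 m s).seq (Runs.case (x := some true) rfl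
    (by simp [contents, bits, BinTree.word]; rfl)
    (by simpa [bits, BinTree.word] using h₂))).mono ?_
  have h₃ : (f a).length ≤ pf.eval (size a) := (length_le_size _).trans (hpf a)
  have h₄ := Nat.mul_le_mul_right (p.eval (M.eval (size a)) + 8 * M.eval (size a) + 5) h₃
  have h₅ := hpf a
  simp only [size, BinTree.size, List.length_append, List.length_reverse, List.length_nil] at *
  omega

end PolyTime

open TreeCode StackProg

namespace PolyTime

variable {α β γ σ : Type} [TreeCode α] [TreeCode β] [TreeCode γ] [TreeCode σ]

@[fun_prop]
theorem not {f : α → Bool} (hf : PolyTime f) : PolyTime fun a => !f a := by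
  have h : PolyTime fun a => bif f a then false else true := by fun_prop
  convert h using 2 with a
  cases f a <;> rfl

@[fun_prop]
theorem and {f g : α → Bool} (hf : PolyTime f) (hg : PolyTime g) :
    PolyTime fun a => f a && g a := by
  have h : PolyTime fun a => bif f a then g a else false := by fun_prop
  convert h using 2 with a
  cases f a <;> rfl

@[fun_prop]
theorem or {f g : α → Bool} (hf : PolyTime f) (hg : PolyTime g) :
    PolyTime fun a => f a || g a := by
  have h : PolyTime fun a => bif f a then true else g a := by fun_prop
  convert h using 2 with a
  cases f a <;> rfl

theorem any {f : α → List β} {p : α → β → Bool} (hf : PolyTime f)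
    (hp : PolyTime fun x : α × β => p x.1 x.2) : PolyTime fun a => (f a).any (p a) := by
  have h : PolyTime fun a => (f a).foldl (fun s b => s || p a b) false := by
    refine foldl (h := fun a s b => s || p a b) hf (.const _) ?_ ⟨3, fun a s b _ => ?_⟩
    · have h₁ : PolyTime fun x : α × Bool × β => p x.1 x.2.2 :=
        hp.comp (f := fun x : α × Bool × β => (x.1, x.2.2)) (by fun_prop)
      fun_prop
    · have := size_bool_le (s || p a b)
      simp; omega
  convert h using 2 with a
  have key : ∀ (l : List β) s, l.foldl (fun s b => s || p a b) s = (s || l.any (p a)) := by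
    intro l
    induction l with
    | nil => simp
    | cons b l ih => intro s; simp [ih, Bool.or_assoc]
  simp [key]

theorem all {f : α → List β} {p : α → β → Bool} (hf : PolyTime f)
    (hp : PolyTime fun x : α × β => p x.1 x.2) : PolyTime fun a => (f a).all (p a) := by
  have h : PolyTime fun a => !(f a).any fun b => !p a b :=
    not (any (p := fun a b => !p a b) hf (by fun_prop))
  convert h using 2 with a
  simp [List.not_any_eq_all_not]

/-- The comparison of bit strings: while the first one is read, the second one is shortened. -/
@[fun_prop]
theorem decide_eq {f g : α → List Bool} (hf : PolyTime f) (hg : PolyTime g) :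
    PolyTime fun a => decide (f a = g a) := by
  let step : List Bool × Bool → Bool → List Bool × Bool := fun s b =>
    (s.1.tail, s.2 && (!s.1.isEmpty && bif b then s.1.headD false else !s.1.headD false))
  have h : PolyTime fun a => (f a).foldl step (g a, true) := by
    refine foldl (h := fun _ => step) hf (by fun_prop) (by fun_prop) ⟨3, fun a s b _ => ?_⟩
    obtain ⟨l, c⟩ := s
    have h₁ : size l.tail ≤ size l := by
      cases l with
      | nil => simp
      | cons b l => simp; omega
    have h₂ := size_bool_le (step (l, c) b).2
    change size (l.tail, (step (l, c) b).2) ≤ _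
    rw [size_pair, size_pair]
    simp; omega
  have h' : PolyTime fun a => ((f a).foldl step (g a, true)).2 &&
    ((f a).foldl step (g a, true)).1.isEmpty := by fun_prop
  convert h' using 2 with a
  have key : ∀ (l l' : List Bool) c,
      ((l.foldl step (l', c)).2 && (l.foldl step (l', c)).1.isEmpty) =
      (c && decide (l = l')) := by
    intro l
    induction l with
    | nil => intro l' c; cases l' <;> simp
    | cons b l ih =>
      intro l' c
      rw [List.foldl_cons, ih]
      cases l' with
      | nil => simp
      | cons b' l' => cases b <;> cases b' <;> simp <;> congr
  rw [key]; simp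

end PolyTime

/-! ### The algorithm -/

namespace ConflictFree

/-- A number, as a bit string. -/
abbrev Word := List Bool

/-- A bracket of the input word. An edge is stored as (color, head, tail), and a pair of vertices as
(second vertex, first vertex, empty word). -/
abbrev Record := Word × Word × Word

/-- The symbols of the input alphabet as triples of bits. -/
def symbolCode : Γ' → Bool × Bool × Bool
  | .bit b => (true, b, false)
  | .ket => (false, true, true)
  | .comma => (false, true, false)
  | .blank => (false, false, true)
  | .bra => (false, false, false)

/-- The state of the parser: the number that is being read, the earlier numbers of the
current bracket, the brackets since the blank, and the brackets before the blank. The bits of the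
numbers and the members of all lists are in reverse order. -/
abbrev ParseState := Word × List Word × List Record × List Record

/-- The parser reads a symbol. -/
def parseStep (s : ParseState) (x : Bool × Bool × Bool) : ParseState :=
  bif x.1 then (x.2.1 :: s.1, s.2)
  else bif x.2.1 then
    bif x.2.2 then ([], [], (s.1, s.2.1.headD [], s.2.1.tail.headD []) :: s.2.2.1, s.2.2.2)
    else ([], s.1 :: s.2.1, s.2.2)
  else
    bif x.2.2 then (s.1, s.2.1, [], s.2.2.1)
    else ([], [], s.2.2)

/-- The state of the parser after it has read the input word. -/
def parse (w : List (Bool × Bool × Bool)) : ParseState :=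
  w.foldl parseStep ([], [], [], [])

/-- The edges in both directions. -/
def bothDirections (l : List Record) : List Record :=
  l.foldl (fun s e => (e.1, e.2.2, e.2.1) :: s) l

/-- Membership in a list of words. -/
def mem (x : Word) (l : List Word) : Bool := l.any fun y => decide (y = x)

/-- The heads of the arcs that satisfy `p`. -/
def heads (p : Record → Bool) (arcs : List Record) : List Word :=
  arcs.foldl (fun s e => bif p e then e.2.1 :: s else s) []

/-- The state of the search for the walks of length `t`: the ends of all of them, of those without
an edge of the chosen color, of those with exactly one such edge, whether the goal is not the end of
a walk of length between `1` and `t`, and whether a walk with exactly one such edge has led to the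
goal before or at the same time as any other walk. -/
abbrev SearchState := List Word × List Word × List Word × Bool × Bool

/-- The next vertex sets of a search, from the sets `A`, `B` and `C` of the ends of all walks, those
without an edge of color `i`, and those with exactly one such edge. -/
def nextSets (arcs : List Record) (i : Word) (A B C : List Word) :
    List Word × List Word × List Word :=
  (heads (fun e => mem e.2.2 A) arcs,
    heads (fun e => !decide (e.1 = i) && mem e.2.2 B) arcs,
    heads (fun e => bif decide (e.1 = i) then mem e.2.2 B else mem e.2.2 C) arcs)

/-- The search goes on from walks of length `t` to those of length `t + 1`. -/
def searchStep (arcs : List Record) (i v : Word) (s : SearchState) : SearchState :=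
  let X := nextSets arcs i s.1 s.2.1 s.2.2.1
  (X.1, X.2.1, X.2.2, s.2.2.2.1 && !mem v X.1, s.2.2.2.2 || (s.2.2.2.1 && mem v X.2.2))

/-- Is there a shortest path from `u` to `v` with exactly one edge of color `i`? The number of
rounds is the number of arcs, which is an upper bound for all distances. -/
def search (arcs : List Record) (i u v : Word) : Bool :=
  (arcs.foldl (fun s _ => searchStep arcs i v s) ([u], [u], [], true, false)).2.2.2.2

/-- The answer for a list of arcs and a list of pairs. -/
def answer (arcs pairs : List Record) : Bool :=
  pairs.all fun q => decide (q.2.1 = q.1) || arcs.any fun e => search arcs e.1 q.2.1 q.1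

/-- The answer for an input word. -/
def decideWord (w : List (Bool × Bool × Bool)) : Bool :=
  answer (bothDirections (parse w).2.2.2) (parse w).2.2.1

/-! ### The algorithm takes polynomial time -/

variable {α : Type} [TreeCode α]

theorem polyTime_parse : PolyTime parse := by
  refine PolyTime.foldl (h := fun _ => parseStep) PolyTime.id (PolyTime.const _) ?_
    ⟨10, fun _ s x _ => ?_⟩
  · unfold parseStep
    fun_prop
  · obtain ⟨c, n, r, e⟩ := s
    obtain ⟨x, y, z⟩ := x
    have hb := size_bool_le y
    have hp := TreeCode.size_pos c
    have hp' := TreeCode.size_pos n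
    have hp'' := TreeCode.size_pos e
    cases x <;> cases y <;> cases z <;> rcases n with _ | ⟨n, _ | ⟨n', l⟩⟩ <;>
      simp [parseStep] at * <;> omega

@[fun_prop]
theorem polyTime_bothDirections {f : α → List Record} (hf : PolyTime f) :
    PolyTime fun a => bothDirections (f a) := by
  refine PolyTime.comp (g := bothDirections) ?_ hf
  refine PolyTime.foldl (h := fun _ s e => (e.1, e.2.2, e.2.1) :: s) PolyTime.id PolyTime.id
    (by fun_prop) ⟨Polynomial.X + 1, fun l s e he => ?_⟩
  have := size_le_of_mem he
  obtain ⟨a, b, c⟩ := e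
  simp at *; omega

@[fun_prop]
theorem polyTime_mem {f : α → Word} {g : α → List Word} (hf : PolyTime f) (hg : PolyTime g) :
    PolyTime fun a => mem (f a) (g a) :=
  PolyTime.any (p := fun a y => decide (y = f a)) hg (by fun_prop)

/-- The size of the next vertex sets does not depend on that of the present ones. This keeps the
state of a search small. -/
theorem size_heads_le (p : Record → Bool) (arcs : List Record) :
    size (heads p arcs) ≤ size arcs := by
  have key : ∀ s, size (arcs.foldl (fun s e => bif p e then e.2.1 :: s else s) s) + 1 ≤
      size s + size arcs := by
    induction arcs with
    | nil => simp
    | cons e l ih =>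
      intro s
      refine (ih _).trans ?_
      obtain ⟨a, b, c⟩ := e
      cases hp : p (a, b, c) <;> simp [hp] <;> omega
  have := key []
  simp only [size_nil] at this
  unfold heads; omega

theorem polyTime_heads {f : α → List Record} {p : α → Record → Bool} (hf : PolyTime f)
    (hp : PolyTime fun x : α × Record => p x.1 x.2) : PolyTime fun a => heads (p a) (f a) := by
  obtain ⟨q, hq⟩ := hf.size_le
  refine PolyTime.foldl (h := fun a s e => bif p a e then e.2.1 :: s else s) hf (.const _) ?_
    ⟨q + 1, fun a s e he => ?_⟩
  · have h₁ : PolyTime fun x : α × List Word × Record => p x.1 x.2.2 :=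
      hp.comp (f := fun x : α × List Word × Record => (x.1, x.2.2)) (by fun_prop)
    fun_prop
  · have h₁ := size_le_of_mem he
    have h₂ := hq a
    obtain ⟨b, c, d⟩ := e
    simp only [size_pair] at h₁
    cases p a (b, c, d) <;> simp; omega

theorem polyTime_nextSets :
    PolyTime fun x : List Record × Word × List Word × List Word × List Word =>
      nextSets x.1 x.2.1 x.2.2.1 x.2.2.2.1 x.2.2.2.2 := by
  unfold nextSets
  refine .pair ?_ (.pair ?_ ?_) <;> refine polyTime_heads (by fun_prop) (by fun_prop)

theorem polyTime_searchStep : PolyTime fun x : (List Record × Word × Word) × SearchState =>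
    searchStep x.1.1 x.1.2.1 x.1.2.2 x.2 := by
  have h : PolyTime fun x : (List Record × Word × Word) × SearchState =>
      nextSets x.1.1 x.1.2.1 x.2.1 x.2.2.1 x.2.2.2.1 :=
    polyTime_nextSets.comp (f := fun x : (List Record × Word × Word) × SearchState =>
      (x.1.1, x.1.2.1, x.2.1, x.2.2.1, x.2.2.2.1)) (by fun_prop)
  unfold searchStep
  fun_prop

@[fun_prop]
theorem polyTime_search {f : α → List Record} {g h k : α → Word} (hf : PolyTime f)
    (hg : PolyTime g) (hh : PolyTime h) (hk : PolyTime k) :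
    PolyTime fun a => search (f a) (g a) (h a) (k a) := by
  refine PolyTime.comp (g := fun x : List Record × Word × Word × Word =>
    search x.1 x.2.1 x.2.2.1 x.2.2.2) (f := fun a => (f a, g a, h a, k a)) ?_ (by fun_prop)
  unfold search
  have key : PolyTime fun x : List Record × Word × Word × Word =>
      x.1.foldl (fun s _ => searchStep x.1 x.2.1 x.2.2.2 s)
        ([x.2.2.1], [x.2.2.1], [], true, false) := by
    refine PolyTime.foldl (h := fun (x : List Record × Word × Word × Word) s (_ : Record) =>
      searchStep x.1 x.2.1 x.2.2.2 s) (by fun_prop) (by fun_prop) ?_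
      ⟨3 * Polynomial.X + 10, fun x s e _ => ?_⟩
    · exact polyTime_searchStep.comp
        (f := fun x : (List Record × Word × Word × Word) × SearchState × Record =>
          ((x.1.1, x.1.2.1, x.1.2.2.2), x.2.1)) (by fun_prop)
    · obtain ⟨arcs, i, u, v⟩ := x
      simp only [searchStep, nextSets, size_pair, Polynomial.eval_add, Polynomial.eval_mul,
        Polynomial.eval_ofNat, Polynomial.eval_X]
      have h₁ := fun p => size_heads_le p arcs
      have h₂ := size_bool_le
      refine (Nat.add_le_add_right (Nat.add_le_add (h₁ _) (Nat.add_le_add_right (Nat.add_le_add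
        (h₁ _) (Nat.add_le_add_right (Nat.add_le_add (h₁ _) (Nat.add_le_add_right (Nat.add_le_add
        (h₂ _) (h₂ _)) _)) _)) _)) _).trans ?_
      omega
  fun_prop

theorem polyTime_decideWord : PolyTime decideWord := by
  have h := polyTime_parse
  have h₁ : PolyTime fun x : ((List Record × List Record) × Record) × Record =>
      search x.1.1.1 x.2.1 x.1.2.2.1 x.1.2.1 :=
    polyTime_search (f := fun x : ((List Record × List Record) × Record) × Record => x.1.1.1)
      (g := fun x => x.2.1) (h := fun x => x.1.2.2.1) (k := fun x => x.1.2.1)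
      (by fun_prop) (by fun_prop) (by fun_prop) (by fun_prop)
  have h₂ : PolyTime fun x : (List Record × List Record) × Record =>
      x.1.1.any fun e => search x.1.1 e.1 x.2.2.1 x.2.1 :=
    PolyTime.any (f := fun x : (List Record × List Record) × Record => x.1.1)
      (p := fun x e => search x.1.1 e.1 x.2.2.1 x.2.1) (by fun_prop) h₁
  have h₃ : PolyTime fun x : (List Record × List Record) × Record =>
      decide (x.2.2.1 = x.2.1) := by fun_prop
  have h₄ : PolyTime fun x : List Record × List Record => answer x.1 x.2 :=
    PolyTime.all (f := fun x : List Record × List Record => x.2)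
      (p := fun x q => decide (q.2.1 = q.1) || x.1.any fun e => search x.1 e.1 q.2.1 q.1)
      (by fun_prop) (h₃.or h₂)
  exact h₄.comp (f := fun w => (bothDirections (parse w).2.2.2, (parse w).2.2.1)) (by fun_prop)

end ConflictFree

/-! ### The Turing machine -/

namespace StackProg
open TreeCode ConflictFree WorkStack

/-- Push a word onto `tmp`. -/
def pushTmp : List Bool → WorkProg
  | [] => .skip
  | b :: w => .seq (.push .tmp b) (pushTmp w)

theorem pushTmp_runs (w : List Bool) (i m s t c) : Runs (pushTmp w) (contents i m s t c)
    (w.length + 1) (contents i m s (w.reverse ++ t) c) := by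
  induction w generalizing t with
  | nil => exact Runs.skip _
  | cons b w ih =>
    have h := (push_tmp_runs b i m s t c).seq (ih (b :: t))
    exact Runs.mono (by simpa [pushTmp] using h) (by simp; omega)

/-- Translate the input word to the tree of the list of its symbols. -/
def readInput : WorkProg :=
  .seq (.loop .inp (fun x => x.isSome) fun x =>
    match x with
    | some g => pushTmp (true :: bits (symbolCode g))
    | none => .skip) (.seq (.push .main false) tmpToMain)

theorem length_bits_symbolCode_le (g : Γ') : (bits (symbolCode g)).length ≤ 11 := by
  change TreeCode.size (symbolCode g) ≤ 11
  have := size_bool_le (symbolCode g).1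
  have := size_bool_le (symbolCode g).2.1
  have := size_bool_le (symbolCode g).2.2
  change TreeCode.size ((symbolCode g).1, (symbolCode g).2.1, (symbolCode g).2.2) ≤ 11
  rw [size_pair, size_pair]; omega

/-- The word of the list is the concatenation of the words of its symbols, each preceded by a `1`,
with a final `0`; it passes through `tmp`, on which it is reversed. -/
theorem readInput_runs (w : List Γ') :
    Runs readInput (contents w [] [] [] []) (60 * w.length + 3)
      (contents [] (bits (w.map symbolCode)) [] [] []) := by
  have key : ∀ t, Runs (.loop .inp (fun x => x.isSome) fun x =>
      match x with
      | some g => pushTmp (true :: bits (symbolCode g))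
      | none => .skip : WorkProg) (contents w [] [] t []) (20 * w.length + 1)
      (contents [] [] [] ((w.flatMap fun g => true :: bits (symbolCode g)).reverse ++ t) []) := by
    induction w with
    | nil => exact fun t => (Runs.loop_exit (x := none) rfl (by simp [contents]) rfl).mono (by simp)
    | cons g w ih =>
      intro t
      refine (Runs.loop_step (x := some g) rfl (by simp [contents]; rfl) rfl
        (pushTmp_runs (true :: bits (symbolCode g)) ..)
        (by simpa using ih ((true :: bits (symbolCode g)).reverse ++ t))).mono ?_
      have := length_bits_symbolCode_le g
      simp; omega
  have hb : ∀ w : List Γ', (w.flatMap fun g => true :: bits (symbolCode g)) ++ [false] =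
      bits (w.map symbolCode) := by
    intro w
    induction w with
    | nil => rfl
    | cons g w ih =>
      rw [List.flatMap_cons, List.append_assoc, ih]
      simp [bits, BinTree.word]
  have hl : (w.flatMap fun g => true :: bits (symbolCode g)).length ≤ 12 * w.length := by
    clear key
    induction w with
    | nil => simp
    | cons g w ih =>
      have := length_bits_symbolCode_le g
      simp at *; omega
  refine Runs.mono (n := (20 * w.length + 1) + (1 +
    (2 * (w.flatMap fun g => true :: bits (symbolCode g)).length + 1))) ?_ (by omega)
  refine (key []).seq ((push_main_runs ..).seq ?_)
  have h := tmpToMain_runs [] [false] []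
    ((w.flatMap fun g => true :: bits (symbolCode g)).reverse) []
  simpa [hb] using h

/-- Replace the tree of a bit by the bit. The tree of `true` is the word `1 0 0`, and that of
`false` is the word `0`. -/
def writeOutput : WorkProg :=
  .case .main fun x => bif x.getD false then
    .case .main fun _ => .case .main fun _ => .push .main true
  else .push .main false

theorem writeOutput_runs (b : Bool) : Runs writeOutput (contents [] (bits b) [] [] []) 4
    (contents [] [b] [] [] []) := by
  cases b
  · exact (Runs.case (x := some false) rfl (by simp [contents, bits, BinTree.word])
      (push_main_runs ..)).mono (by omega)
  · exact (Runs.case (x := some true) rfl (by simp [contents, bits, BinTree.word]; rfl)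
      (Runs.case (x := some false) rfl (by simp [contents]; rfl)
        (Runs.case (x := some false) rfl (by simp [contents]) (push_main_runs ..))))

/-- The Turing machine that executes a program and then resets its internal state and halts. -/
noncomputable def toFinTM2 (c : WorkProg) : Turing.FinTM2 where
  K := WorkStack
  kFin := inferInstance
  k₀ := .inp
  k₁ := .main
  Γ := WorkStack.Symbol
  Λ := Option (Label c)
  main := some (entry c)
  ΛFin := letI := labelFintype c; inferInstance
  σ := ∀ k : WorkStack, Option k.Symbol
  initialState := fun _ => none
  σFin := inferInstance
  Γk₀Fin := inferInstanceAs (Fintype Γ')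
  m l := match l with
    | some l => compile c some none l
    | none => .load (fun _ _ => none) .halt

theorem toFinTM2_outputs {c : WorkProg} {w : List Γ'} {b : Bool} {n : ℕ}
    (h : Runs c (contents w [] [] [] []) n (contents [] [b] [] [] [])) :
    Nonempty (Turing.TM2OutputsInTime (toFinTM2 c) w (some (encodeBool b)) (n + 1)) := by
  obtain ⟨i, hi, e⟩ := h
  obtain ⟨v, hv⟩ := e.compile_evals (toFinTM2 c).m some none (fun _ => rfl) fun _ => none
  have h₁ : Turing.initList (toFinTM2 c) w =
      ⟨some (some (entry c)), fun _ => none, contents w [] [] [] []⟩ := by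
    simp only [Turing.initList, toFinTM2]
    congr 1
    funext k
    cases k <;> rfl
  have h₂ : Turing.haltList (toFinTM2 c) (encodeBool b) =
      ⟨none, fun _ => none, contents [] [b] [] [] []⟩ := by
    simp only [Turing.haltList, toFinTM2]
    congr 1
    funext k
    cases k <;> rfl
  refine ⟨⟨⟨i + 1, ?_⟩, Nat.add_le_add_right hi 1⟩⟩
  rw [Nat.add_comm, Function.iterate_add_apply]
  rw [h₁]
  exact (congrArg _ hv).trans (congrArg some h₂.symm)

/-- A polynomial-time function of the list of the symbols of the input word is computed by a Turing
machine in polynomial time. -/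
theorem exists_tm2ComputableInPolyTime {α : Type} (ea : α → List Γ')
    {f : List (Bool × Bool × Bool) → Bool} (hf : PolyTime f) :
    Nonempty (Turing.TM2ComputableInPolyTime ea encodeBool
      fun a => f ((ea a).map symbolCode)) := by
  obtain ⟨c, p, hc⟩ := hf
  have hsize : ∀ w : List Γ', TreeCode.size (w.map symbolCode) ≤ 12 * w.length + 1 := by
    intro w
    induction w with
    | nil => simp
    | cons g w ih =>
      have h : TreeCode.size (symbolCode g) ≤ 11 := length_bits_symbolCode_le g
      simp only [List.map_cons, size_cons, List.length_cons]; omega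
  have hrun : ∀ w : List Γ', Runs (.seq readInput (.seq c writeOutput))
      (contents w [] [] [] []) (60 * w.length + 3 + (p.eval (12 * w.length + 1) + 4))
      (contents [] [f (w.map symbolCode)] [] [] []) := by
    intro w
    refine (readInput_runs w).seq (.seq (.mono ?_ (p.eval_nat_mono (hsize w)))
      (writeOutput_runs _))
    simpa using (hc (w.map symbolCode)).2 [] []
  refine ⟨{
    tm := toFinTM2 (.seq readInput (.seq c writeOutput))
    inputAlphabet := Equiv.refl Γ'
    outputAlphabet := Equiv.refl Bool
    time := 60 * Polynomial.X + 3 + (p.comp (12 * Polynomial.X + 1) + 4) + 1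
    outputsFun := fun a => Classical.choice ?_ }⟩
  have h : ∀ (w : List Γ') (o : List Bool) (n : ℕ), w = ea a →
      o = encodeBool (f ((ea a).map symbolCode)) →
      n = 60 * (ea a).length + 3 + (p.eval (12 * (ea a).length + 1) + 4) + 1 →
      Nonempty (Turing.TM2OutputsInTime (toFinTM2 (.seq readInput (.seq c writeOutput)))
        w (some o) n) := by
    rintro _ _ _ rfl rfl rfl
    exact toFinTM2_outputs (hrun (ea a))
  exact h _ _ _ (List.map_id _) (List.map_id _) (by simp)

end StackProg

/-! ### Conflict-free shortest paths -/

namespace SimpleGraph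

variable {V C : Type*} {G : SimpleGraph V}

open Classical in
/-- The number of edges of color `i` of a walk, with multiplicity. -/
noncomputable def Walk.colorCount (c : G.edgeSet → C) (i : C) {u v : V} (p : G.Walk u v) : ℕ :=
  p.edges.countP fun e => ∃ h : e ∈ G.edgeSet, c ⟨e, h⟩ = i

theorem Walk.colorCount_nil (c : G.edgeSet → C) (i : C) (u : V) :
    (Walk.nil : G.Walk u u).colorCount c i = 0 := rfl

open Classical in
theorem Walk.colorCount_concat (c : G.edgeSet → C) (i : C) {u v w : V} (p : G.Walk u v)
    (h : G.Adj v w) : (p.concat h).colorCount c i =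
      p.colorCount c i + if c ⟨s(v, w), h⟩ = i then 1 else 0 := by
  simp only [colorCount, Walk.edges_concat, List.concat_eq_append, List.countP_append,
    List.countP_singleton]
  congr 1
  have h' : G.Adj v w := h
  simp [h']

theorem Walk.exists_of_colorCount_ne_zero {c : G.edgeSet → C} {i : C} {u v : V} {p : G.Walk u v}
    (h : p.colorCount c i ≠ 0) : ∃ e, c e = i := by
  classical
  obtain ⟨e, _, he⟩ := List.countP_pos_iff.1 (Nat.pos_of_ne_zero h)
  obtain ⟨he, hi⟩ := of_decide_eq_true he
  exact ⟨_, hi⟩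

theorem Walk.IsPath.isConflictFree_iff {c : G.edgeSet → C} {u v : V} {p : G.Walk u v}
    (hp : p.IsPath) : p.IsConflictFree c ↔ ∃ i, p.colorCount c i = 1 := by
  classical
  refine exists_congr fun i => ?_
  rw [colorCount, List.countP_eq_length_filter, List.length_eq_one_iff]
  have hnd := hp.isTrail.edges_nodup.filter fun e => decide (∃ h : e ∈ G.edgeSet, c ⟨e, h⟩ = i)
  constructor
  · rintro ⟨e, ⟨he, hi⟩, huniq⟩
    refine ⟨e, (List.perm_singleton.1 ?_)⟩
    refine (List.perm_ext_iff_of_nodup hnd (List.nodup_singleton _)).2 fun e' => ?_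
    simp only [List.mem_filter, decide_eq_true_eq, List.mem_singleton]
    constructor
    · rintro ⟨h₁, h₂, h₃⟩
      exact congrArg Subtype.val (huniq ⟨e', h₂⟩ ⟨h₁, h₃⟩)
    · rintro rfl
      exact ⟨he, e.2, hi⟩
  · rintro ⟨e, he⟩
    have hmem : ∀ e', (e' ∈ p.edges ∧ ∃ h : e' ∈ G.edgeSet, c ⟨e', h⟩ = i) ↔ e' = e := fun e' => by
      have h : e' ∈ p.edges.filter (fun e => decide (∃ h : e ∈ G.edgeSet, c ⟨e, h⟩ = i)) ↔
          e' ∈ [e] := by rw [he]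
      simpa only [List.mem_filter, decide_eq_true_eq, List.mem_singleton] using h
    obtain ⟨h₁, h₂, h₃⟩ := (hmem e).2 rfl
    exact ⟨⟨e, h₂⟩, ⟨h₁, h₃⟩, fun e' h => Subtype.ext ((hmem e').1 ⟨h.1, e'.2, h.2⟩)⟩

theorem stronglyConflictFreeConnectedPair_iff (c : G.edgeSet → C) (u v : V) :
    G.StronglyConflictFreeConnectedPair c u v ↔
      ∃ i, ∃ p : G.Walk u v, p.length = G.dist u v ∧ p.colorCount c i = 1 := by
  constructor
  · rintro ⟨p, hp, hl, hc⟩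
    obtain ⟨i, hi⟩ := hp.isConflictFree_iff.1 hc
    exact ⟨i, p, hl, hi⟩
  · rintro ⟨i, p, hl, hi⟩
    have hp := p.isPath_of_length_eq_dist hl
    exact ⟨p, hp, hl, hp.isConflictFree_iff.2 ⟨i, hi⟩⟩

theorem Walk.exists_adj_of_mem_support_tail {u v w : V} (p : G.Walk u v)
    (h : w ∈ p.support.tail) : ∃ x, G.Adj x w := by
  induction p with
  | nil => simp at h
  | @cons a b d e p ih =>
    rw [Walk.support_cons, List.tail_cons, ← Walk.cons_tail_support, List.mem_cons] at h
    rcases h with rfl | h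
    · exact ⟨_, e⟩
    · exact ih h

end SimpleGraph

/-! ### The algorithm is correct -/

namespace ConflictFree

theorem mem_eq_true {x : Word} {l : List Word} : mem x l = true ↔ x ∈ l := by
  simp [mem]

theorem mem_heads {p : Record → Bool} {arcs : List Record} {w : Word} :
    w ∈ heads p arcs ↔ ∃ e ∈ arcs, p e = true ∧ e.2.1 = w := by
  have key : ∀ s, w ∈ arcs.foldl (fun s e => bif p e then e.2.1 :: s else s) s ↔
      w ∈ s ∨ ∃ e ∈ arcs, p e = true ∧ e.2.1 = w := by
    induction arcs with
    | nil => simp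
    | cons e l ih =>
      intro s
      rw [List.foldl_cons, ih]
      cases hp : p e
      · simp [hp]
      · simp only [hp, cond_true, List.mem_cons, exists_eq_or_imp, true_and, eq_comm (a := w)]
        tauto
  exact (key []).trans (by simp)

theorem mem_bothDirections {l : List Record} {i y x : Word} :
    (i, y, x) ∈ bothDirections l ↔ (i, y, x) ∈ l ∨ (i, x, y) ∈ l := by
  have key : ∀ l s : List Record, (i, y, x) ∈ l.foldl (fun s e => (e.1, e.2.2, e.2.1) :: s) s ↔
      (i, y, x) ∈ s ∨ (i, x, y) ∈ l := by
    intro l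
    induction l with
    | nil => simp
    | cons e l ih =>
      intro s
      rw [List.foldl_cons, ih]
      obtain ⟨a, b, c⟩ := e
      simp only [List.mem_cons, Prod.mk.injEq]
      tauto
  exact key l l

section Search

variable {V C : Type*} {G : SimpleGraph V} {c : G.edgeSet → C} {keyV : V → Word}
  {keyC : C → Word} {arcs : List Record}

/-- The arcs of the list are the edges of the graph in both directions, with their colors. -/
def IsArcList (c : G.edgeSet → C) (keyV : V → Word) (keyC : C → Word) (arcs : List Record) : Prop :=
  ∀ i y x, (i, y, x) ∈ arcs ↔
    ∃ u v, ∃ h : G.Adj u v, x = keyV u ∧ y = keyV v ∧ i = keyC (c ⟨s(u, v), h⟩)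

/-- A list consists of the words of the vertices with the property `Q`. -/
def Represents (keyV : V → Word) (l : List Word) (Q : V → Prop) : Prop :=
  ∀ w, w ∈ l ↔ ∃ y, Q y ∧ keyV y = w

theorem Represents.mem_iff {l : List Word} {Q : V → Prop} (h : Represents keyV l Q)
    (hV : Function.Injective keyV) (v : V) : mem (keyV v) l = true ↔ Q v := by
  rw [mem_eq_true, h]
  exact ⟨fun ⟨y, hy, e⟩ => hV e ▸ hy, fun hv => ⟨v, hv, rfl⟩⟩

/-- The heads of those arcs that satisfy `p`, if `p` stands for a property of the tail and of the
color. -/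
theorem IsArcList.represents_heads (harcs : IsArcList c keyV keyC arcs) {p : Record → Bool}
    {R : V → C → Prop}
    (hp : ∀ u v (h : G.Adj u v), p (keyC (c ⟨s(u, v), h⟩), keyV v, keyV u) = true ↔
      R u (c ⟨s(u, v), h⟩)) :
    Represents keyV (heads p arcs) fun y => ∃ u, ∃ h : G.Adj u y, R u (c ⟨s(u, y), h⟩) := by
  intro w
  rw [mem_heads]
  constructor
  · rintro ⟨⟨i, y, x⟩, he, hpe, rfl⟩
    obtain ⟨u, v, h, rfl, rfl, rfl⟩ := (harcs _ _ _).1 he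
    exact ⟨v, ⟨u, h, (hp u v h).1 hpe⟩, rfl⟩
  · rintro ⟨v, ⟨u, h, hR⟩, rfl⟩
    exact ⟨_, (harcs _ _ _).2 ⟨u, v, h, rfl, rfl, rfl⟩, (hp u v h).2 hR, rfl⟩

/-- The meaning of the state of a search from `u` to `v` with the color `i` after `t` rounds. -/
structure SearchInvariant (c : G.edgeSet → C) (keyV : V → Word) (i : C) (u v : V) (t : ℕ)
    (s : SearchState) : Prop where
  walks : Represents keyV s.1 fun y => ∃ p : G.Walk u y, p.length = t
  none : Represents keyV s.2.1 fun y => ∃ p : G.Walk u y, p.length = t ∧ p.colorCount c i = 0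
  one : Represents keyV s.2.2.1 fun y => ∃ p : G.Walk u y, p.length = t ∧ p.colorCount c i = 1
  fresh : s.2.2.2.1 = true ↔ ∀ p : G.Walk u v, p.length = 0 ∨ t < p.length
  found : s.2.2.2.2 = true ↔ ∃ p : G.Walk u v, p.length ≠ 0 ∧ p.length ≤ t ∧
    p.colorCount c i = 1 ∧ ∀ q : G.Walk u v, q.length = 0 ∨ p.length ≤ q.length

theorem searchInvariant_init (c : G.edgeSet → C) (keyV : V → Word) (i : C) (u v : V) :
    SearchInvariant c keyV i u v 0 ([keyV u], [keyV u], [], true, false) where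
  walks w := by
    simp only [List.mem_singleton]
    constructor
    · rintro rfl
      exact ⟨u, ⟨.nil, rfl⟩, rfl⟩
    · rintro ⟨y, ⟨p, hp⟩, rfl⟩
      rw [p.eq_of_length_eq_zero hp]
  none w := by
    simp only [List.mem_singleton]
    constructor
    · rintro rfl
      exact ⟨u, ⟨.nil, rfl, rfl⟩, rfl⟩
    · rintro ⟨y, ⟨p, hp, _⟩, rfl⟩
      rw [p.eq_of_length_eq_zero hp]
  one w := by
    simp only [List.not_mem_nil, false_iff]
    rintro ⟨y, ⟨p, hp, h⟩, rfl⟩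
    cases p with
    | nil => simp [SimpleGraph.Walk.colorCount_nil] at h
    | cons => simp at hp
  fresh := ⟨fun _ _ => Nat.eq_zero_or_pos _, fun _ => rfl⟩
  found := by
    simp only [Bool.false_eq_true, false_iff]
    rintro ⟨p, h₁, h₂, _⟩
    omega

theorem exists_walk_succ_iff (u y : V) (t : ℕ) (P : ∀ x, G.Walk u x → Prop) :
    (∃ p : G.Walk u y, p.length = t + 1 ∧ P y p) ↔
      ∃ x, ∃ h : G.Adj x y, ∃ p : G.Walk u x, p.length = t ∧ P y (p.concat h) := by
  constructor
  · rintro ⟨p, hp, hP⟩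
    cases p with
    | nil => simp at hp
    | cons h p =>
      obtain ⟨x, q, h', e⟩ := SimpleGraph.Walk.exists_cons_eq_concat h p
      rw [e] at hp hP
      exact ⟨x, h', q, by simpa using hp, hP⟩
  · rintro ⟨x, h, p, hp, hP⟩
    exact ⟨p.concat h, by simpa using hp, hP⟩

/-- A walk of length `t + 1` is a walk of length `t` and one more edge, which is of color `i` or
not. -/
theorem SearchInvariant.step (harcs : IsArcList c keyV keyC arcs) (hV : Function.Injective keyV)
    (hC : Function.Injective keyC) {i : C} {u v : V} {t : ℕ} {s : SearchState}
    (h : SearchInvariant c keyV i u v t s) :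
    SearchInvariant c keyV i u v (t + 1) (searchStep arcs (keyC i) (keyV v) s) := by
  classical
  have hw : Represents keyV (searchStep arcs (keyC i) (keyV v) s).1
      fun y => ∃ p : G.Walk u y, p.length = t + 1 := by
    have h₁ := harcs.represents_heads (p := fun e => mem e.2.2 s.1)
      (R := fun x _ => ∃ p : G.Walk u x, p.length = t) fun x y _ => h.walks.mem_iff hV x
    refine fun w => (h₁ w).trans (exists_congr fun y => and_congr_left fun _ => ?_)
    simpa using (exists_walk_succ_iff u y t fun _ _ => True).symm
  have hn : Represents keyV (searchStep arcs (keyC i) (keyV v) s).2.1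
      fun y => ∃ p : G.Walk u y, p.length = t + 1 ∧ p.colorCount c i = 0 := by
    have h₁ := harcs.represents_heads
      (p := fun e => !decide (e.1 = keyC i) && mem e.2.2 s.2.1)
      (R := fun x j => j ≠ i ∧ ∃ p : G.Walk u x, p.length = t ∧ p.colorCount c i = 0)
      fun x y _ => by simp [h.none.mem_iff hV x, hC.eq_iff]
    refine fun w => (h₁ w).trans (exists_congr fun y => and_congr_left fun _ => ?_)
    refine Iff.trans ?_ (exists_walk_succ_iff u y t fun _ p => p.colorCount c i = 0).symm
    refine exists_congr fun x => exists_congr fun hxy => ?_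
    simp only [SimpleGraph.Walk.colorCount_concat]
    by_cases hi : c ⟨s(x, y), hxy⟩ = i <;> simp [hi]
  have ho : Represents keyV (searchStep arcs (keyC i) (keyV v) s).2.2.1
      fun y => ∃ p : G.Walk u y, p.length = t + 1 ∧ p.colorCount c i = 1 := by
    have h₁ := harcs.represents_heads
      (p := fun e => bif decide (e.1 = keyC i) then mem e.2.2 s.2.1 else mem e.2.2 s.2.2.1)
      (R := fun x j => if j = i then ∃ p : G.Walk u x, p.length = t ∧ p.colorCount c i = 0
        else ∃ p : G.Walk u x, p.length = t ∧ p.colorCount c i = 1)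
      fun x y hxy => by
        by_cases hi : c ⟨s(x, y), hxy⟩ = i <;>
          simp [h.none.mem_iff hV x, h.one.mem_iff hV x, hC.eq_iff, hi]
    refine fun w => (h₁ w).trans (exists_congr fun y => and_congr_left fun _ => ?_)
    refine Iff.trans ?_ (exists_walk_succ_iff u y t fun _ p => p.colorCount c i = 1).symm
    refine exists_congr fun x => exists_congr fun hxy => ?_
    simp only [SimpleGraph.Walk.colorCount_concat]
    by_cases hi : c ⟨s(x, y), hxy⟩ = i <;> simp [hi]
  refine ⟨hw, hn, ho, ?_, ?_⟩
  · change (s.2.2.2.1 && !mem (keyV v) (searchStep arcs (keyC i) (keyV v) s).1) = true ↔ _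
    rw [Bool.and_eq_true, h.fresh, Bool.not_eq_true', ← Bool.not_eq_true, hw.mem_iff hV v]
    constructor
    · rintro ⟨h₁, h₂⟩ p
      have := h₁ p
      have : p.length ≠ t + 1 := fun e => h₂ ⟨p, e⟩
      omega
    · intro h₁
      refine ⟨fun p => ?_, ?_⟩
      · have := h₁ p; omega
      · rintro ⟨p, hp⟩
        have := h₁ p; omega
  · change (s.2.2.2.2 || (s.2.2.2.1 &&
      mem (keyV v) (searchStep arcs (keyC i) (keyV v) s).2.2.1)) = true ↔ _
    rw [Bool.or_eq_true, Bool.and_eq_true, h.fresh, h.found, ho.mem_iff hV v]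
    constructor
    · rintro (⟨p, h₁, h₂, h₃⟩ | ⟨h₁, p, h₂, h₃⟩)
      · exact ⟨p, h₁, by omega, h₃⟩
      · refine ⟨p, by omega, by omega, h₃, fun q => ?_⟩
        have := h₁ q; omega
    · rintro ⟨p, h₁, h₂, h₃, h₄⟩
      by_cases hp : p.length ≤ t
      · exact .inl ⟨p, h₁, hp, h₃, h₄⟩
      · refine .inr ⟨fun q => ?_, p, by omega, h₃⟩
        have := h₄ q; omega

/-- The vertices of a shortest path other than the first one are distinct heads of arcs. -/
theorem IsArcList.dist_le_length (harcs : IsArcList c keyV keyC arcs)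
    (hV : Function.Injective keyV) {u v : V} (h : G.Reachable u v) :
    G.dist u v ≤ arcs.length := by
  obtain ⟨p, hp, hl⟩ := h.exists_path_of_dist
  have hnd : (p.support.tail.map keyV).Nodup := hp.support_nodup.tail.map hV
  have hsub : p.support.tail.map keyV ⊆ arcs.map fun e => e.2.1 := by
    intro w hw
    obtain ⟨y, hy, rfl⟩ := List.mem_map.1 hw
    obtain ⟨x, hxy⟩ := p.exists_adj_of_mem_support_tail hy
    exact List.mem_map.2 ⟨_, (harcs _ _ _).2 ⟨x, y, hxy, rfl, rfl, rfl⟩, rfl⟩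
  have := (hnd.subperm hsub).length_le
  simpa [hl] using this

theorem search_iff (harcs : IsArcList c keyV keyC arcs) (hV : Function.Injective keyV)
    (hC : Function.Injective keyC) (i : C) {u v : V} (huv : u ≠ v) :
    search arcs (keyC i) (keyV u) (keyV v) = true ↔
      ∃ p : G.Walk u v, p.length = G.dist u v ∧ p.colorCount c i = 1 := by
  have hinv : ∀ t, SearchInvariant c keyV i u v t
      ((fun s => searchStep arcs (keyC i) (keyV v) s)^[t]
        ([keyV u], [keyV u], [], true, false)) := by
    intro t
    induction t with
    | zero => exact searchInvariant_init c keyV i u v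
    | succ t ih =>
      rw [Function.iterate_succ_apply']
      exact ih.step harcs hV hC
  have hpos : ∀ p : G.Walk u v, p.length ≠ 0 := fun p hp => huv (p.eq_of_length_eq_zero hp)
  rw [search, List.foldl_const, (hinv arcs.length).found]
  constructor
  · rintro ⟨p, _, _, h₃, h₄⟩
    obtain ⟨q, hq⟩ := p.reachable.exists_walk_length_eq_dist
    have := h₄ q
    have := hpos q
    have := SimpleGraph.dist_le p
    exact ⟨p, by omega, h₃⟩
  · rintro ⟨p, h₁, h₂⟩
    refine ⟨p, hpos p, h₁ ▸ harcs.dist_le_length hV p.reachable, h₂, fun q => .inr ?_⟩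
    exact h₁ ▸ SimpleGraph.dist_le q

theorem any_search_iff (harcs : IsArcList c keyV keyC arcs) (hV : Function.Injective keyV)
    (hC : Function.Injective keyC) {u v : V} (huv : u ≠ v) :
    (arcs.any fun e => search arcs e.1 (keyV u) (keyV v)) = true ↔
      G.StronglyConflictFreeConnectedPair c u v := by
  rw [SimpleGraph.stronglyConflictFreeConnectedPair_iff, List.any_eq_true]
  constructor
  · rintro ⟨⟨j, y, x⟩, he, h⟩
    obtain ⟨a, b, hab, rfl, rfl, rfl⟩ := (harcs _ _ _).1 he
    exact ⟨_, (search_iff harcs hV hC _ huv).1 h⟩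
  · rintro ⟨i, p, hl, hp⟩
    obtain ⟨⟨e, he⟩, rfl⟩ := p.exists_of_colorCount_ne_zero (by rw [hp]; exact one_ne_zero)
    induction e with | h a b =>
    exact ⟨_, (harcs _ _ _).2 ⟨a, b, he, rfl, rfl, rfl⟩,
      (search_iff harcs hV hC _ huv).2 ⟨p, hl, hp⟩⟩

end Search

/-! ### The input word -/

/-- The word by which the algorithm represents a number. -/
def key (a : ℕ) : Word := (encodeNat a).reverse

theorem key_injective : Function.Injective key := fun a b h => by
  rw [← decode_encodeNat a, ← decode_encodeNat b, List.reverse_injective h]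

theorem parse_number (a : ℕ) (w : Word) (s : List Word × List Record × List Record) :
    ((ColoredGraphWithPairs.encodeNumber a).map symbolCode).foldl parseStep (w, s) =
      (key a ++ w, s) := by
  have h : ∀ (l : List Bool) (w : Word),
      ((l.map inclusionBoolΓ').map symbolCode).foldl parseStep (w, s) = (l.reverse ++ w, s) := by
    intro l
    induction l with
    | nil => exact fun _ => rfl
    | cons b l ih =>
      intro w
      refine (ih (b :: w)).trans ?_
      simp
  exact h _ _

theorem parse_edges {n k : ℕ} (l : List (Fin n × Fin n × Fin k)) (s : ParseState) :
    (((l.flatMap fun e => [Γ'.bra] ++ ColoredGraphWithPairs.encodeNumber e.1 ++ [Γ'.comma] ++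
      ColoredGraphWithPairs.encodeNumber e.2.1 ++ [Γ'.comma] ++
        ColoredGraphWithPairs.encodeNumber e.2.2 ++ [Γ'.ket]).map symbolCode).foldl
          parseStep s).2.2 =
      ((l.map fun e => (key e.2.2, key e.2.1, key e.1)).reverse ++ s.2.2.1, s.2.2.2) := by
  induction l generalizing s with
  | nil => rfl
  | cons e l ih =>
    rw [List.flatMap_cons, List.map_append, List.foldl_append, ih]
    simp [parse_number, parseStep, symbolCode]

theorem parse_pairs {n : ℕ} (l : List (Fin n × Fin n)) (s : ParseState) :
    (((l.flatMap fun q => [Γ'.bra] ++ ColoredGraphWithPairs.encodeNumber q.1 ++ [Γ'.comma] ++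
      ColoredGraphWithPairs.encodeNumber q.2 ++ [Γ'.ket]).map symbolCode).foldl parseStep s).2.2 =
      ((l.map fun q => (key q.2, key q.1, [])).reverse ++ s.2.2.1, s.2.2.2) := by
  induction l generalizing s with
  | nil => rfl
  | cons e l ih =>
    rw [List.flatMap_cons, List.map_append, List.foldl_append, ih]
    simp [parse_number, parseStep, symbolCode]

/-- The number of vertices and the number of colors are read like the first numbers of a bracket,
and forgotten when the first bracket opens or at the end. -/
theorem parse_encode (I : ColoredGraphWithPairs) : (parse (I.encode.map symbolCode)).2.2 =
    ((I.pairList.map fun q => (key q.2, key q.1, [])).reverse,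
      (I.edgeList.map fun e => (key e.2.2, key e.2.1, key e.1)).reverse) := by
  unfold ColoredGraphWithPairs.encode parse
  rw [List.map_append, List.foldl_append, parse_pairs, List.map_append, List.foldl_append]
  have h : ∀ s : ParseState, (([Γ'.blank].map symbolCode).foldl parseStep s).2.2 =
    ([], s.2.2.1) := fun s => rfl
  rw [h, List.map_append, List.foldl_append, parse_edges]
  simp [parse_number, parseStep, symbolCode]

theorem mem_edgeList (I : ColoredGraphWithPairs) (u v : Fin I.n) (i : Fin I.k) :
    (u, v, i) ∈ I.edgeList ↔ u < v ∧ ∃ h : I.G.Adj u v, I.c ⟨s(u, v), h⟩ = i := by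
  simp only [ColoredGraphWithPairs.edgeList, List.mem_flatMap, List.mem_finRange, true_and,
    List.mem_filterMap]
  constructor
  · rintro ⟨u', v', h⟩
    split_ifs at h with h'
    cases h
    exact ⟨h'.1, h'.2, rfl⟩
  · rintro ⟨h₁, h₂, rfl⟩
    exact ⟨u, v, by rw [dif_pos ⟨h₁, h₂⟩]⟩

theorem mem_pairList (I : ColoredGraphWithPairs) (q : Fin I.n × Fin I.n) :
    q ∈ I.pairList ↔ q ∈ I.P := by
  simp only [ColoredGraphWithPairs.pairList, List.mem_flatMap, List.mem_finRange, true_and,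
    List.mem_filterMap]
  constructor
  · rintro ⟨u, v, h⟩
    split_ifs at h with h'
    cases h
    exact h'
  · intro h
    exact ⟨q.1, q.2, by rw [if_pos h]⟩

theorem isArcList_parse (I : ColoredGraphWithPairs) :
    IsArcList I.c (fun u => key u) (fun i => key i)
      (bothDirections (parse (I.encode.map symbolCode)).2.2.2) := by
  intro i y x
  rw [mem_bothDirections, parse_encode]
  simp only [List.mem_reverse, List.mem_map, Prod.exists, mem_edgeList, Prod.mk.injEq]
  constructor
  · rintro (⟨u, v, j, ⟨_, h, rfl⟩, rfl, rfl, rfl⟩ | ⟨u, v, j, ⟨_, h, rfl⟩, rfl, rfl, rfl⟩)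
    · exact ⟨u, v, h, rfl, rfl, rfl⟩
    · exact ⟨v, u, h.symm, rfl, rfl, by simp only [Sym2.eq_swap]⟩
  · rintro ⟨u, v, h, rfl, rfl, rfl⟩
    rcases lt_or_gt_of_ne h.ne with huv | huv
    · exact .inl ⟨u, v, _, ⟨huv, h, rfl⟩, rfl, rfl, rfl⟩
    · exact .inr ⟨v, u, _, ⟨huv, h.symm, rfl⟩, by simp only [Sym2.eq_swap], rfl, rfl⟩

theorem decideWord_encode_iff (I : ColoredGraphWithPairs) :
    decideWord (I.encode.map symbolCode) = true ↔
      I.G.SubsetStronglyConflictFreeConnected I.c I.P := by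
  have hinj : ∀ m, Function.Injective fun a : Fin m => key a :=
    fun m => key_injective.comp Fin.val_injective
  have harcs := isArcList_parse I
  rw [decideWord, answer, List.all_eq_true]
  generalize bothDirections (parse (I.encode.map symbolCode)).2.2.2 = arcs at harcs
  rw [parse_encode]
  simp only [List.mem_reverse, List.forall_mem_map, mem_pairList, Bool.or_eq_true,
    decide_eq_true_eq]
  refine forall₂_congr fun q _ => ?_
  by_cases h : q.1 = q.2
  · simp [h]
  · have h' : key q.1 ≠ key q.2 := fun e => h (hinj _ e)
    simp only [h', false_or, ne_eq, h, not_false_eq_true, forall_const]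
    exact any_search_iff harcs (hinj _) (hinj _) h

end ConflictFree

/-- There is a Turing machine, running in time polynomial in the length of the input word, that
decides whether all pairs in `P` are strongly conflict-free connected. -/
theorem mainTheorem7 :
    ∃ decision : ColoredGraphWithPairs → Bool,
      (∀ I : ColoredGraphWithPairs,
        decision I = true ↔ I.G.SubsetStronglyConflictFreeConnected I.c I.P) ∧
      Nonempty (Turing.TM2ComputableInPolyTime ColoredGraphWithPairs.encode
        Computability.encodeBool decision) :=
  ⟨fun I => ConflictFree.decideWord (I.encode.map ConflictFree.symbolCode),
    ConflictFree.decideWord_encode_iff,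
    StackProg.exists_tm2ComputableInPolyTime _ ConflictFree.polyTime_decideWord⟩
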